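/- **Setting.** Let $\mathcal X$ (environment) and $\mathcal Y$ (agent) be disjoint sets of propositional variables and let $\varphi$ be an LTL$_f$ formula in negation normal form over $\mathcal X\cup\mathcal Y$ (constructors $\mathtt{true},\mathtt{false},p,\neg p,\wedge,\vee$, next $\circ$, weak next $\bullet$, until $\mathcal U$, release $\mathcal R$), interpreted over finite, possibly empty traces: at a position $i<|\rho|$, $\circ\psi$ holds iff $i+1<|\rho|$ and $\psi$ holds at $i+1$, and $\bullet\psi$ holds iff $i+1<|\rho|$ implies that $\psi$ holds at $i+1$; on the empty trace $\epsilon$ literals, $\circ$- and $\mathcal U$-formulas are false, $\bullet$- and $\mathcal R$-formulas are true. A strategy $g:(2^{\mathcal X})^*\to 2^{\mathcal Y}$ is *winning* for $\varphi$ if for every infinite sequence $X_0,X_1,\dots$ of subsets of $\mathcal X$ some finite prefix, possibly empty, of the play $X_0\cup g(\epsilon),\ X_1\cup g(X_0),\ X_2\cup g(X_0,X_1),\dots$ satisfies $\varphi$ (if $\epsilon\not\models\varphi$, the prefix is necessarily nonempty). $\varphi$ is *realizable* if a winning strategy exists. **Formula operations.** Write $\Diamond\mathit{true}=\mathtt{true}\,\mathcal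 U\,\mathtt{true}$ and $\Box\mathit{false}=\mathtt{false}\,\mathcal R\,\mathtt{false}$. The next normal form $\mathsf{xnf}$ commutes with $\wedge,\vee$, satisfies $\mathsf{xnf}(\varphi_1\mathcal U\varphi_2)=(\mathsf{xnf}(\varphi_2)\wedge\Diamond\mathit{true})\vee(\mathsf{xnf}(\varphi_1)\wedge\circ(\varphi_1\mathcal U\varphi_2))$ and $\mathsf{xnf}(\varphi_1\mathcal R\varphi_2)=(\mathsf{xnf}(\varphi_2)\vee\Box\mathit{false})\wedge(\mathsf{xnf}(\varphi_1)\vee\bullet(\varphi_1\mathcal R\varphi_2))$, and fixes constants, literals, $\circ$- and $\bullet$-formulas, $\Diamond\mathit{true}$ and $\Box\mathit{false}$. The propositionalization $\psi^p$ replaces each maximal temporal subformula $\alpha$ by a variable $a_\alpha$. $\textsc{RmNext}$ commutes with $\wedge,\vee$, fixes constants, and maps $a_{\Diamond\mathit{true}}\mapsto\mathtt{true}$, $a_{\Box\mathit{false}}\mapsto\mathtt{false}$, $a_{\circ\theta}\mapsto\theta\wedge\Diamond\mathit{true}$, $a_{\bullet\theta}\mapsto\theta\vee\Box\mathit{false}$.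 **Expansion (DPLL).** The arcs of an OR-node $\psi$ are generated from $\mathsf{xnf}(\psi)^p$ by repeatedly choosing a literal $\ell$ on an occurring agent variable (by an arbitrary fixed branching rule), replacing first $\ell$ and afterwards $\neg\ell$ by true, with simplification, until no agent variable occurs; each leaf yields the pair (partial assignment, remaining formula), the latter being an AND-node. The arcs of an AND-node are generated likewise by branching on environment variables; a leaf with remaining formula $\Psi$ yields (partial assignment, OR-node $\textsc{RmNext}(\Psi)$). Replacement with simplification may be any operation whose result is classically propositionally equivalent to the substitution instance, does not contain the replaced variable and introduces no variables. **Search.** $\textsc{Search}(n,\mathsf{path})$ on an OR-node $n$ returns True if $n$ is tagged success; otherwise False if $n$ is tagged failure; otherwise, if $n$ is on the path, it tags $n$ as loop and returns False; otherwise, if $\epsilon\models n$, it tags $n$ success with the empty move and returns True. Otherwise it goes through the or-arcs $(act,m)$ of $n$ and, for each, through the and-arcs $(resp,succ)$ of $m$, calling $\textsc{Search}(succ,[\mathsf{path}\mid n])$ and leaving the inner loop at the first False. If all calls for some $m$ return True, it tags $n$ success with move $act$, calls $\textsc{BackProp}(n)$ if $n$ is tagged loop, and returns True. If no or-arc succeeds,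 it tags $n$ failure and returns False. All tests compare nodes up to a given equivalence check. $\textsc{BackProp}(n)$ considers the failure-tagged ancestors of $n$ in the explored graph: it repeatedly tags as success those that have an AND-node all of whose successors are tagged success, and removes the failure tags of the remaining ones (they were obtained while $n$ was assumed to fail). The synthesis procedure immediately returns a strategy with the empty move if $\epsilon\models\varphi$; otherwise it calls $\textsc{Search}(\varphi,\emptyset)$ and returns the recorded moves as a controller (a partial map from state formulas to partial assignments of $\mathcal Y$), or "unrealizable". **Equivalence checks.** $\textsc{HashConsingEqCheck}$: the two formulas have the same syntax tree. $\textsc{BddBasedEqCheck}$: the reduced ordered BDDs of $\mathsf{xnf}(\psi_1)^p$ and $\mathsf{xnf}(\psi_2)^p$, for a fixed variable order, are equal; the BDD variables are the literals and the temporal formulas (a literal $p$ and its negation count as separate variables, as in propositional equivalence over assignments $C\subseteq\mathsf{pa}(\psi_1)\cup\mathsf{pa}(\psi_2)$), and the order may be any list that contains all literals and temporal formulas of which $\mathsf{xnf}(\theta)$ is a Boolean combination, for $\theta$ a subformula of $\varphi$, $\Diamond\mathit{true}$ or $\Box\mathit{false}$. **Theorem.** For every $\varphi$ and every threshold $t\in\mathbb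 N$, consider the following procedure: run the synthesis procedure with $\textsc{HashConsingEqCheck}$ and the DPLL-based expansion; as soon as the formula of a generated search node (OR-node or AND-node) has size greater than $t$, abort and start afresh with $\textsc{BddBasedEqCheck}$, the DPLL-based expansion and no threshold. This procedure always terminates, and it is correct: it returns a controller if and only if $\varphi$ is realizable (and "unrealizable" otherwise), and a returned controller is winning, that is, some strategy follows it, and every agent strategy that follows it, with don't-care variables chosen arbitrarily, is winning for $\varphi$. -/

import Mathlib

namespace LTLfSynthesis

universe u v

/-! ## Formulas, finite traces, semantics -/

/-- Formulas of linear temporal logic on finite traces, in negation normal form. -/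
inductive LTLf (P : Type u) : Type u
  | tt : LTLf P
  | ff : LTLf P
  | atom : P → LTLf P
  | natom : P → LTLf P
  | and : LTLf P → LTLf P → LTLf P
  | or : LTLf P → LTLf P → LTLf P
  | next : LTLf P → LTLf P
  | wnext : LTLf P → LTLf P
  | untl : LTLf P → LTLf P → LTLf P
  | rel : LTLf P → LTLf P → LTLf P
  deriving DecidableEq

namespace LTLf

variable {P : Type u}

/-- `ρ, i ⊨ φ`. Positions `i ≥ |ρ|` behave as the empty trace: there every literal, every
next- and every until-formula is false, every weak-next- and every release-formula is true. -/
def Sat (ρ : List (Set P)) : LTLf P → ℕ → Prop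
  | tt, _ => True
  | ff, _ => False
  | atom p, i => ∃ σ, ρ[i]? = some σ ∧ p ∈ σ
  | natom p, i => ∃ σ, ρ[i]? = some σ ∧ p ∉ σ
  | and a b, i => Sat ρ a i ∧ Sat ρ b i
  | or a b, i => Sat ρ a i ∨ Sat ρ b i
  | next a, i => i + 1 < ρ.length ∧ Sat ρ a (i + 1)
  | wnext a, i => i + 1 < ρ.length → Sat ρ a (i + 1)
  | untl a b, i => ∃ j, i ≤ j ∧ j < ρ.length ∧ Sat ρ b j ∧ ∀ k, i ≤ k → k < j → Sat ρ a k
  | rel a b, i => ∀ j, i ≤ j → j < ρ.length → Sat ρ b j ∨ ∃ k, i ≤ k ∧ k < j ∧ Sat ρ a k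

/-- `ρ ⊨ φ`. -/
def Models (ρ : List (Set P)) (φ : LTLf P) : Prop := Sat ρ φ 0

/-- IsAccepting: whether the empty trace satisfies the formula. -/
def isAccepting : LTLf P → Bool
  | tt => true
  | ff => false
  | atom _ => false
  | natom _ => false
  | and a b => a.isAccepting && b.isAccepting
  | or a b => a.isAccepting || b.isAccepting
  | next _ => false
  | wnext _ => true
  | untl _ _ => false
  | rel _ _ => true

theorem isAccepting_iff (φ : LTLf P) : φ.isAccepting = true ↔ Models [] φ := by
  induction φ <;> simp_all [isAccepting, Models, Sat]

/-- Number of nodes of the syntax tree. -/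
def size : LTLf P → ℕ
  | tt => 1
  | ff => 1
  | atom _ => 1
  | natom _ => 2
  | and a b => a.size + b.size + 1
  | or a b => a.size + b.size + 1
  | next a => a.size + 1
  | wnext a => a.size + 1
  | untl a b => a.size + b.size + 1
  | rel a b => a.size + b.size + 1

/-- Eventually true: the trace has not ended. -/
abbrev evTrue : LTLf P := untl tt tt

/-- Always false: the trace has ended. -/
abbrev alwFalse : LTLf P := rel ff ff

/-- The transformation to neXt Normal Form. -/
def xnf : LTLf P → LTLf P
  | untl tt tt => evTrue
  | rel ff ff => alwFalse
  | and a b => and a.xnf b.xnf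
  | or a b => or a.xnf b.xnf
  | untl a b => or (and b.xnf evTrue) (and a.xnf (next (untl a b)))
  | rel a b => and (or b.xnf alwFalse) (or a.xnf (wnext (rel a b)))
  | φ => φ

/-- All subformulas. -/
def subformulas : LTLf P → List (LTLf P)
  | and a b => and a b :: (a.subformulas ++ b.subformulas)
  | or a b => or a b :: (a.subformulas ++ b.subformulas)
  | next a => next a :: a.subformulas
  | wnext a => wnext a :: a.subformulas
  | untl a b => untl a b :: (a.subformulas ++ b.subformulas)
  | rel a b => rel a b :: (a.subformulas ++ b.subformulas)
  | φ => [φ]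

/-- `cl(φ)`, which includes the subformulas of eventually-true and of always-false. -/
def cl (φ : LTLf P) : List (LTLf P) :=
  φ.subformulas ++ evTrue.subformulas ++ alwFalse.subformulas

/-- `pa(φ)`: the literals and temporal formulas of which `φ` is a Boolean combination. -/
def pa : LTLf P → List (LTLf P)
  | tt => []
  | ff => []
  | and a b => a.pa ++ b.pa
  | or a b => a.pa ++ b.pa
  | φ => [φ]

end LTLf

/-! ## Propositionalized formulas -/

/-- Propositionalized formulas: `st α` is the propositional variable that stands for the temporal
formula `α`. -/
inductive PForm (P : Type u) : Type u
  | tt : PForm P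
  | ff : PForm P
  | pos : P → PForm P
  | neg : P → PForm P
  | st : LTLf P → PForm P
  | and : PForm P → PForm P → PForm P
  | or : PForm P → PForm P → PForm P

/-- The propositionalization `φ^p`. -/
def LTLf.prop {P : Type u} : LTLf P → PForm P
  | tt => .tt
  | ff => .ff
  | atom p => .pos p
  | natom p => .neg p
  | and a b => .and a.prop b.prop
  | or a b => .or a.prop b.prop
  | φ => .st φ

namespace PForm

variable {P : Type u}

/-- The inverse operation of propositionalization. -/
def tf : PForm P → LTLf P
  | tt => .tt
  | ff => .ff
  | pos p => .atom p
  | neg p => .natom p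
  | st α => α
  | and a b => .and a.tf b.tf
  | or a b => .or a.tf b.tf

/-- The truth value when the atomic propositions have the values `σ` and the variables that stand
for temporal formulas have the values `z`. -/
def eval (σ : P → Bool) (z : LTLf P → Bool) : PForm P → Bool
  | tt => true
  | ff => false
  | pos p => σ p
  | neg p => !σ p
  | st α => z α
  | and a b => a.eval σ z && b.eval σ z
  | or a b => a.eval σ z || b.eval σ z

/-- The truth value as a positive Boolean formula over `pa`, under an assignment `C` of truth
values to literals and temporal formulas. -/
def evalPa (C : LTLf P → Bool) : PForm P → Bool
  | tt => true
  | ff => false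
  | pos p => C (.atom p)
  | neg p => C (.natom p)
  | st α => C α
  | and a b => a.evalPa C && b.evalPa C
  | or a b => a.evalPa C || b.evalPa C

/-- The temporal formulas `α` whose variable occurs in a propositionalized formula. -/
def states : PForm P → Set (LTLf P)
  | st α => {α}
  | and a b => a.states ∪ b.states
  | or a b => a.states ∪ b.states
  | _ => ∅

/-- RmNext. (The remaining cases do not arise, since it is only applied to formulas in XNF
from which all atomic propositions have been eliminated.) -/
def rmNext : PForm P → LTLf P
  | st (.untl .tt .tt) => .tt
  | st (.rel .ff .ff) => .ff
  | st (.next α) => .and α .evTrue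
  | st (.wnext α) => .or α .alwFalse
  | and a b => .and a.rmNext b.rmNext
  | or a b => .or a.rmNext b.rmNext
  | f => f.tf

variable [DecidableEq P]

/-- The atomic propositions that occur in a propositionalized formula (outside of `st`). -/
def vars : PForm P → Finset P
  | pos p => {p}
  | neg p => {p}
  | and a b => a.vars ∪ b.vars
  | or a b => a.vars ∪ b.vars
  | _ => ∅

end PForm

/-- A realization of Replace: the given literal `l` (an atomic proposition with a truth value) is
replaced by its truth value in the propositional formula, and the result is simplified
propositionally, without introducing variables. -/
structure Replacement (P : Type u) [DecidableEq P] where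
  replace : PForm P → P × Bool → PForm P
  eval_replace : ∀ f l σ z, (replace f l).eval σ z =
    f.eval (Function.update σ l.1 l.2) z
  vars_replace : ∀ f l, (replace f l).vars ⊆ f.vars.erase l.1
  states_replace : ∀ f l, (replace f l).states ⊆ f.states

section StandardReplacement

variable {P : Type u}

/-- Conjunction, simplified by the rules for neutral and absorbing truth values. -/
def PForm.simpAnd : PForm P → PForm P → PForm P
  | .tt, b => b
  | .ff, _ => .ff
  | a, .tt => a
  | _, .ff => .ff
  | a, b => .and a b

/-- Disjunction, simplified by the rules for neutral and absorbing truth values. -/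
def PForm.simpOr : PForm P → PForm P → PForm P
  | .ff, b => b
  | .tt, _ => .tt
  | a, .ff => a
  | _, .tt => .tt
  | a, b => .or a b

/-- A propositional constant. -/
def PForm.const : Bool → PForm P
  | true => .tt
  | false => .ff

/-- Replace with the usual simplification rules. -/
def PForm.stdReplace [DecidableEq P] (l : P × Bool) : PForm P → PForm P
  | .pos p => if p = l.1 then .const l.2 else .pos p
  | .neg p => if p = l.1 then .const (!l.2) else .neg p
  | .and a b => .simpAnd (a.stdReplace l) (b.stdReplace l)
  | .or a b => .simpOr (a.stdReplace l) (b.stdReplace l)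
  | f => f

theorem PForm.eval_simpAnd (σ : P → Bool) (z : LTLf P → Bool) (a b : PForm P) :
    (PForm.simpAnd a b).eval σ z = (a.eval σ z && b.eval σ z) := by
  cases a <;> cases b <;> simp [PForm.simpAnd, PForm.eval]

theorem PForm.eval_simpOr (σ : P → Bool) (z : LTLf P → Bool) (a b : PForm P) :
    (PForm.simpOr a b).eval σ z = (a.eval σ z || b.eval σ z) := by
  cases a <;> cases b <;> simp [PForm.simpOr, PForm.eval]

theorem PForm.vars_simpAnd [DecidableEq P] (a b : PForm P) :
    (PForm.simpAnd a b).vars ⊆ a.vars ∪ b.vars := by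
  cases a <;> cases b <;> simp [PForm.simpAnd, PForm.vars]

theorem PForm.vars_simpOr [DecidableEq P] (a b : PForm P) :
    (PForm.simpOr a b).vars ⊆ a.vars ∪ b.vars := by
  cases a <;> cases b <;> simp [PForm.simpOr, PForm.vars]

theorem PForm.states_simpAnd (a b : PForm P) :
    (PForm.simpAnd a b).states ⊆ a.states ∪ b.states := by
  cases a <;> cases b <;> simp [PForm.simpAnd, PForm.states]

theorem PForm.states_simpOr (a b : PForm P) :
    (PForm.simpOr a b).states ⊆ a.states ∪ b.states := by
  cases a <;> cases b <;> simp [PForm.simpOr, PForm.states]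

end StandardReplacement

/-- The usual simplification rules are a realization of Replace. -/
def Replacement.standard (P : Type u) [DecidableEq P] : Replacement P where
  replace f l := f.stdReplace l
  eval_replace f l σ z := by
    induction f with
    | pos p =>
      by_cases h : p = l.1
      · cases hl : l.2 <;>
          simp [PForm.stdReplace, h, hl, PForm.const, PForm.eval]
      · simp [PForm.stdReplace, h, PForm.eval]
    | neg p =>
      by_cases h : p = l.1
      · cases hl : l.2 <;>
          simp [PForm.stdReplace, h, hl, PForm.const, PForm.eval]
      · simp [PForm.stdReplace, h, PForm.eval]
    | and a b iha ihb => simp [PForm.stdReplace, PForm.eval_simpAnd, PForm.eval, iha, ihb]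
    | or a b iha ihb => simp [PForm.stdReplace, PForm.eval_simpOr, PForm.eval, iha, ihb]
    | st α => simp [PForm.stdReplace, PForm.eval]
    | tt => simp [PForm.stdReplace, PForm.eval]
    | ff => simp [PForm.stdReplace, PForm.eval]
  vars_replace f l := by
    induction f with
    | pos p =>
      by_cases h : p = l.1
      · cases hl : l.2 <;> simp [PForm.stdReplace, h, hl, PForm.const, PForm.vars]
      · simp [PForm.stdReplace, h, PForm.vars, Ne.symm h]
    | neg p =>
      by_cases h : p = l.1
      · cases hl : l.2 <;> simp [PForm.stdReplace, h, hl, PForm.const, PForm.vars]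
      · simp [PForm.stdReplace, h, PForm.vars, Ne.symm h]
    | and a b iha ihb =>
      simp only [PForm.stdReplace, PForm.vars, Finset.erase_union_distrib]
      exact (PForm.vars_simpAnd _ _).trans (Finset.union_subset_union iha ihb)
    | or a b iha ihb =>
      simp only [PForm.stdReplace, PForm.vars, Finset.erase_union_distrib]
      exact (PForm.vars_simpOr _ _).trans (Finset.union_subset_union iha ihb)
    | st α => simp [PForm.stdReplace, PForm.vars]
    | tt => simp [PForm.stdReplace, PForm.vars]
    | ff => simp [PForm.stdReplace, PForm.vars]
  states_replace f l := by
    induction f with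
    | pos p =>
      by_cases h : p = l.1
      · cases hl : l.2 <;> simp [PForm.stdReplace, h, hl, PForm.const, PForm.states]
      · simp [PForm.stdReplace, h, PForm.states]
    | neg p =>
      by_cases h : p = l.1
      · cases hl : l.2 <;> simp [PForm.stdReplace, h, hl, PForm.const, PForm.states]
      · simp [PForm.stdReplace, h, PForm.states]
    | and a b iha ihb =>
      exact (PForm.states_simpAnd _ _).trans (Set.union_subset_union iha ihb)
    | or a b iha ihb =>
      exact (PForm.states_simpOr _ _).trans (Set.union_subset_union iha ihb)
    | st α => exact subset_rfl
    | tt => exact subset_rfl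
    | ff => exact subset_rfl

/-! ## The DPLL-based expansion of search nodes

Atomic propositions are the elements of `X ⊕ Y`: those of `X` are controlled by the environment,
those of `Y` by the agent. Search nodes are represented by their formulas. -/

section Expansion

variable {X : Type u} {Y : Type v} [DecidableEq X] [DecidableEq Y]

/-- GetAgentVars. -/
def PForm.agentVars (f : PForm (X ⊕ Y)) : Finset Y := f.vars.toRight

/-- GetEnvVars. -/
def PForm.envVars (f : PForm (X ⊕ Y)) : Finset X := f.vars.toLeft

/-- A realization of GetBranchingLiteral, for OR-nodes (agent variables) and for AND-nodes
(environment variables): an occurring variable, with the truth value to be tried first. -/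
structure Branching (X : Type u) (Y : Type v) [DecidableEq X] [DecidableEq Y] where
  agent : (f : PForm (X ⊕ Y)) → f.agentVars.Nonempty → {y // y ∈ f.agentVars} × Bool
  env : (f : PForm (X ⊕ Y)) → f.envVars.Nonempty → {x // x ∈ f.envVars} × Bool

/-- A move: a partial truth assignment, as a list of literals. Variables that are absent are
"don't care". -/
abbrev Move (V : Type*) := List (V × Bool)

theorem card_agentVars_replace_lt (R : Replacement (X ⊕ Y)) (f : PForm (X ⊕ Y)) (y : Y)
    (hy : y ∈ f.agentVars) (b : Bool) :
    (R.replace f (Sum.inr y, b)).agentVars.card < f.agentVars.card := by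
  refine Finset.card_lt_card ⟨fun z hz => ?_, fun h => ?_⟩
  · have := R.vars_replace f (Sum.inr y, b) (Finset.mem_toRight.1 hz)
    exact Finset.mem_toRight.2 (Finset.mem_of_mem_erase this)
  · have := R.vars_replace f (Sum.inr y, b) (Finset.mem_toRight.1 (h hy))
    simp at this

theorem card_envVars_replace_lt (R : Replacement (X ⊕ Y)) (f : PForm (X ⊕ Y)) (x : X)
    (hx : x ∈ f.envVars) (b : Bool) :
    (R.replace f (Sum.inl x, b)).envVars.card < f.envVars.card := by
  refine Finset.card_lt_card ⟨fun z hz => ?_, fun h => ?_⟩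
  · have := R.vars_replace f (Sum.inl x, b) (Finset.mem_toLeft.1 hz)
    exact Finset.mem_toLeft.2 (Finset.mem_of_mem_erase this)
  · have := R.vars_replace f (Sum.inl x, b) (Finset.mem_toLeft.1 (h hx))
    simp at this

/-- DpllGetOrArcs: the list of the pairs (agent move, AND-node) in the order in which they are
generated. -/
def dpllGetOrArcs (B : Branching X Y) (R : Replacement (X ⊕ Y)) (f : PForm (X ⊕ Y))
    (ass : Move Y) : List (Move Y × LTLf (X ⊕ Y)) :=
  if h : f.agentVars.Nonempty then
    let y : Y := (B.agent f h).1
    let b : Bool := (B.agent f h).2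
    dpllGetOrArcs B R (R.replace f (Sum.inr y, b)) (ass ++ [(y, b)]) ++
      dpllGetOrArcs B R (R.replace f (Sum.inr y, !b)) (ass ++ [(y, !b)])
  else
    [(ass, f.tf)]
termination_by f.agentVars.card
decreasing_by
  all_goals exact card_agentVars_replace_lt R f _ (B.agent f h).1.2 _

/-- DpllGetAndArcs: the list of the pairs (environment move, successor OR-node) in the order in
which they are generated. -/
def dpllGetAndArcs (B : Branching X Y) (R : Replacement (X ⊕ Y)) (f : PForm (X ⊕ Y))
    (ass : Move X) : List (Move X × LTLf (X ⊕ Y)) :=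
  if h : f.envVars.Nonempty then
    let x : X := (B.env f h).1
    let b : Bool := (B.env f h).2
    dpllGetAndArcs B R (R.replace f (Sum.inl x, b)) (ass ++ [(x, b)]) ++
      dpllGetAndArcs B R (R.replace f (Sum.inl x, !b)) (ass ++ [(x, !b)])
  else
    [(ass, f.rmNext)]
termination_by f.envVars.card
decreasing_by
  all_goals exact card_envVars_replace_lt R f _ (B.env f h).1.2 _

/-- DpllGetArcs on an OR-node. -/
def orArcs (B : Branching X Y) (R : Replacement (X ⊕ Y)) (ψ : LTLf (X ⊕ Y)) :
    List (Move Y × LTLf (X ⊕ Y)) :=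
  dpllGetOrArcs B R ψ.xnf.prop []

/-- DpllGetArcs on an AND-node. -/
def andArcs (B : Branching X Y) (R : Replacement (X ⊕ Y)) (m : LTLf (X ⊕ Y)) :
    List (Move X × LTLf (X ⊕ Y)) :=
  dpllGetAndArcs B R m.xnf.prop []

end Expansion

/-! ## Equivalence checks -/

/-- Ordered binary decision diagrams with variables in `A`. -/
inductive Bdd (A : Type u) : Type u
  | leaf : Bool → Bdd A
  | node : A → Bdd A → Bdd A → Bdd A
  deriving DecidableEq

section Equivalence

variable {P : Type u} [DecidableEq P]

/-- The unique-table constructor: a node with equal children is redundant. -/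
def Bdd.mk {A : Type u} [DecidableEq A] (a : A) (lo hi : Bdd A) : Bdd A :=
  if lo = hi then lo else .node a lo hi

/-- The reduced ordered BDD of `f` for the variable order given by the list, by Shannon
expansion (`C` records the values of the variables that have been expanded). -/
def bddRepresentation (f : PForm P) : List (LTLf P) → (LTLf P → Bool) → Bdd (LTLf P)
  | [], C => .leaf (f.evalPa C)
  | a :: ord, C => .mk a (bddRepresentation f ord (Function.update C a false))
      (bddRepresentation f ord (Function.update C a true))

/-- BddBasedEqCheck for the variable order `ord`. As in the definition of propositional
equivalence, the Boolean variables are the elements of `pa`, i.e. the literals and the temporal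
formulas. (`p` and `¬p` are both false on the empty trace, so they are separate variables.) -/
def bddBasedEqCheck (ord : List (LTLf P)) (ψ₁ ψ₂ : LTLf P) : Bool :=
  decide (bddRepresentation ψ₁.xnf.prop ord (fun _ => false) =
    bddRepresentation ψ₂.xnf.prop ord (fun _ => false))

/-- HashConsingEqCheck: the formulas have the same syntax tree. -/
def hashConsingEqCheck (ψ₁ ψ₂ : LTLf P) : Bool := decide (ψ₁ = ψ₂)

/-- `ord` lists all variables over which the XNF of state formulas of the problem `φ` is
defined: the literals and temporal formulas in `pa(xnf(θ))` for `θ ∈ cl(φ)`. -/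
def IsVariableOrder (φ : LTLf P) (ord : List (LTLf P)) : Prop :=
  ∀ θ ∈ φ.cl, ∀ α ∈ θ.xnf.pa, α ∈ ord

end Equivalence

/-! ## The AND-OR graph search -/

section Search

variable {X : Type u} {Y : Type v} [DecidableEq X] [DecidableEq Y]

/-- The parameters of a run of the search. -/
structure Config (X : Type u) (Y : Type v) [DecidableEq X] [DecidableEq Y] where
  /-- EquivalenceCheck -/
  eqCheck : LTLf (X ⊕ Y) → LTLf (X ⊕ Y) → Bool
  /-- size threshold for formulas of generated nodes, if any -/
  threshold : Option ℕ
  /-- GetBranchingLiteral -/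
  branching : Branching X Y
  /-- Replace -/
  repl : Replacement (X ⊕ Y)

/-- The mutable state of the search: tags, OR-nodes of the graph whose expansion has begun, and
the strategy under construction (the most recent entry first). -/
structure SearchState (X : Type u) (Y : Type v) where
  success : List (LTLf (X ⊕ Y))
  failure : List (LTLf (X ⊕ Y))
  loop : List (LTLf (X ⊕ Y))
  expanded : List (LTLf (X ⊕ Y))
  strategy : List (LTLf (X ⊕ Y) × Move Y)

/-- Outcome of running a recursive procedure with bounded recursion depth. Since every call loops
over finite lists only, an execution terminates iff a large enough bound on the recursion depth is
never hit. -/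
inductive Run (α : Type*)
  /-- the bound on the recursion depth was hit -/
  | outOfFuel : Run α
  /-- the execution was aborted, because a generated node exceeds the size threshold -/
  | abort : Run α
  /-- the execution ended and returned a value -/
  | done : α → Run α

namespace Config

variable (c : Config X Y)

/-- Whether a list of tagged nodes (or a path) has a node equivalent to `n`. -/
def mem (n : LTLf (X ⊕ Y)) (l : List (LTLf (X ⊕ Y))) : Bool := l.any fun m => c.eqCheck n m

/-- Whether a node with formula `ψ` exceeds the size threshold. -/
def tooBig (ψ : LTLf (X ⊕ Y)) : Bool :=
  match c.threshold with
  | none => false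
  | some t => decide (t < ψ.size)

/-- TagSuccessNode, together with AddToStrategy. -/
def tagSuccess (n : LTLf (X ⊕ Y)) (act : Move Y) (s : SearchState X Y) : SearchState X Y :=
  { s with success := n :: s.success, strategy := (n, act) :: s.strategy }

/-- Whether all successors of an AND-node are tagged as success nodes. -/
def allSucceed (s : SearchState X Y) (m : LTLf (X ⊕ Y)) : Bool :=
  (andArcs c.branching c.repl m).all fun a => c.mem a.2 s.success

/-- Whether some successor OR-node of the OR-node `q` is equivalent to an element of `l`. -/
def hasSuccessorIn (l : List (LTLf (X ⊕ Y))) (q : LTLf (X ⊕ Y)) : Bool :=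
  (orArcs c.branching c.repl q).any fun o =>
    (andArcs c.branching c.repl o.2).any fun a => c.mem a.2 l

/-- The OR-nodes of the search graph that are proper ancestors of `n`: iterated predecessors. -/
def ancestors (s : SearchState X Y) (n : LTLf (X ⊕ Y)) : List (LTLf (X ⊕ Y)) :=
  (fun l => s.expanded.filter (c.hasSuccessorIn (n :: l)))^[s.expanded.length] []

/-- If the OR-node `p` is not tagged as success and has an AND-node all of whose successors are
success nodes, then tag `p` as success and record the corresponding agent move. -/
def promote (s : SearchState X Y) (p : LTLf (X ⊕ Y)) : SearchState X Y :=
  if c.mem p s.success then s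
  else match (orArcs c.branching c.repl p).find? fun o => c.allSucceed s o.2 with
    | none => s
    | some o => tagSuccess p o.1 s

/-- BackProp: the node `n`, at which a loop had been found and which was temporarily considered
as a failure, has turned out to be a success node. This is propagated backward to those ancestors
of `n` that are tagged as failure nodes: they become success nodes as far as success follows
from the current success tags, and the others are no longer tagged as failure nodes (their
failure was established under the assumption that `n` fails). -/
def backProp (n : LTLf (X ⊕ Y)) (s : SearchState X Y) : SearchState X Y :=
  let anc := s.failure.filter fun f => c.mem f (c.ancestors s n)
  let s' := (fun s => anc.foldl c.promote s)^[anc.length] s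
  { s' with failure := s.failure.filter fun f => !c.mem f (c.ancestors s n) }

/-- The loop over the and-arcs of an AND-node; `search` is the recursive call. -/
def andLoop (search : LTLf (X ⊕ Y) → SearchState X Y → Run (Bool × SearchState X Y)) :
    List (Move X × LTLf (X ⊕ Y)) → SearchState X Y → Run (Bool × SearchState X Y)
  | [], s => .done (true, s)
  | (_, succ) :: arcs, s =>
    if c.tooBig succ then .abort
    else match search succ s with
      | .outOfFuel => .outOfFuel
      | .abort => .abort
      | .done (false, s') => .done (false, s')
      | .done (true, s') => andLoop search arcs s'

/-- The loop over the or-arcs of the OR-node `n`; `search` is the recursive call. -/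
def orLoop (search : LTLf (X ⊕ Y) → SearchState X Y → Run (Bool × SearchState X Y))
    (n : LTLf (X ⊕ Y)) :
    List (Move Y × LTLf (X ⊕ Y)) → SearchState X Y → Run (Bool × SearchState X Y)
  | [], s => .done (false, { s with failure := n :: s.failure })
  | (act, m) :: arcs, s =>
    if c.tooBig m then .abort
    else match c.andLoop search (andArcs c.branching c.repl m) s with
      | .outOfFuel => .outOfFuel
      | .abort => .abort
      | .done (false, s') => orLoop search n arcs s'
      | .done (true, s') =>
        let s'' := tagSuccess n act s'
        .done (true, if c.mem n s''.loop then c.backProp n s'' else s'')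

/-- Search, with the recursion depth bounded by the first argument. -/
def search : ℕ → LTLf (X ⊕ Y) → List (LTLf (X ⊕ Y)) → SearchState X Y →
    Run (Bool × SearchState X Y)
  | 0, _, _, _ => .outOfFuel
  | fuel + 1, n, path, s =>
    if c.mem n s.success then .done (true, s)
    else if c.mem n s.failure then .done (false, s)
    else if c.mem n path then .done (false, { s with loop := n :: s.loop })
    else if n.isAccepting then .done (true, tagSuccess n [] s)
    else c.orLoop (fun succ => search fuel succ (n :: path)) n
      (orArcs c.branching c.repl n) { s with expanded := n :: s.expanded }

end Config

/-- A finite-state controller: a partial function from states (formulas) to agent moves. -/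
abbrev Controller (X : Type u) (Y : Type v) := LTLf (X ⊕ Y) → Option (Move Y)

namespace Config

variable (c : Config X Y)

/-- GetStrategy: the move recorded for a node equivalent to the given state. -/
def getStrategy (s : SearchState X Y) : Controller X Y := fun ψ =>
  (s.strategy.find? fun e => c.eqCheck ψ e.1).map Prod.snd

/-- Synthesis: a controller, or `none` for "unrealizable". -/
def synthesis (fuel : ℕ) (φ : LTLf (X ⊕ Y)) : Run (Option (Controller X Y)) :=
  let s₀ : SearchState X Y := ⟨[], [], [], [], []⟩
  if φ.isAccepting then .done (some (c.getStrategy { s₀ with strategy := [(φ, [])] }))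
  else if c.tooBig φ then .abort
  else match c.search fuel φ [] s₀ with
    | .outOfFuel => .outOfFuel
    | .abort => .abort
    | .done (true, s) => .done (some (c.getStrategy s))
    | .done (false, _) => .done none

end Config

/-- Search with syntactic state equivalence and size threshold `t`; if it is aborted, then the
search is started afresh with the BDD-based check and without threshold. -/
def hashThenBddSynthesis (B : Branching X Y) (R : Replacement (X ⊕ Y))
    (ord : List (LTLf (X ⊕ Y))) (t fuel : ℕ) (φ : LTLf (X ⊕ Y)) :
    Run (Option (Controller X Y)) :=
  match (Config.mk hashConsingEqCheck (some t) B R).synthesis fuel φ with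
  | .abort => (Config.mk (bddBasedEqCheck ord) none B R).synthesis fuel φ
  | r => r

end Search

/-! ## Synthesis problem and winning controllers -/

section Winning

variable {X : Type u} {Y : Type v}

/-- The interpretation in which exactly the variables of `A` and of `B` are true. -/
def letter (A : Set X) (B : Set Y) : Set (X ⊕ Y) := Sum.inl '' A ∪ Sum.inr '' B

/-- The first `k` steps of the play in which the environment plays `env` and the agent `g`. -/
def play (g : List (Set X) → Set Y) (env : ℕ → Set X) (k : ℕ) : List (Set (X ⊕ Y)) :=
  (List.range k).map fun i => letter (env i) (g ((List.range i).map env))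

/-- The agent strategy `g` is winning for `φ`: every play has a finite prefix that satisfies `φ`
(the empty prefix is admitted). -/
def Wins (φ : LTLf (X ⊕ Y)) (g : List (Set X) → Set Y) : Prop :=
  ∀ env : ℕ → Set X, ∃ k : ℕ, LTLf.Models (play g env k) φ

theorem wins_iff_of_not_models_nil (φ : LTLf (X ⊕ Y)) (h : ¬ LTLf.Models [] φ)
    (g : List (Set X) → Set Y) :
    Wins φ g ↔ ∀ env : ℕ → Set X, ∃ k : ℕ, LTLf.Models (play g env (k + 1)) φ := by
  refine forall_congr' fun env => ⟨?_, fun ⟨k, hk⟩ => ⟨k + 1, hk⟩⟩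
  rintro ⟨_ | k, hk⟩
  · exact absurd hk h
  · exact ⟨k, hk⟩

/-- The synthesis problem `(φ, X, Y)` has a solution. -/
def Realizable (φ : LTLf (X ⊕ Y)) : Prop := ∃ g : List (Set X) → Set Y, Wins φ g

/-- The set `S` of true variables agrees with a partial assignment. -/
def Agrees {V : Type*} (S : Set V) (ass : Move V) : Prop := ∀ l ∈ ass, (l.1 ∈ S ↔ l.2 = true)

variable [DecidableEq X] [DecidableEq Y]

/-- `StateAfter B R φ g h ψ`: when the agent plays `g`, the state formula after the sequence `h`
of environment moves is `ψ`; the state evolves along the arcs of the search graph. -/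
inductive StateAfter (B : Branching X Y) (R : Replacement (X ⊕ Y)) (φ : LTLf (X ⊕ Y))
    (g : List (Set X) → Set Y) : List (Set X) → LTLf (X ⊕ Y) → Prop
  | init : StateAfter B R φ g [] φ
  | step {h : List (Set X)} {ψ m ψ' : LTLf (X ⊕ Y)} {act : Move Y} {resp : Move X} {A : Set X} :
      StateAfter B R φ g h ψ → (act, m) ∈ orArcs B R ψ → Agrees (g h) act →
      (resp, ψ') ∈ andArcs B R m → Agrees A resp → StateAfter B R φ g (h ++ [A]) ψ'

/-- The strategy `g` follows the controller: it agrees with the move that the controller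
prescribes in the current state, if any. (Don't-care variables are chosen arbitrarily.) -/
def Follows (B : Branching X Y) (R : Replacement (X ⊕ Y)) (φ : LTLf (X ⊕ Y))
    (ctrl : Controller X Y) (g : List (Set X) → Set Y) : Prop :=
  ∀ h ψ act, StateAfter B R φ g h ψ → ctrl ψ = some act → Agrees (g h) act

/-- The controller can be followed, and every strategy that follows it is winning. -/
def Controller.IsWinning (B : Branching X Y) (R : Replacement (X ⊕ Y)) (φ : LTLf (X ⊕ Y))
    (ctrl : Controller X Y) : Prop :=
  (∃ g, Follows B R φ ctrl g) ∧ ∀ g, Follows B R φ ctrl g → Wins φ g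

end Winning

end LTLfSynthesis

open LTLfSynthesis

/-!
The proof separates what the formulas mean, what the equivalence checks have to guarantee, and what
the depth-first search maintains.

*Progression.* By `Step.models_cons_iff`, a nonempty trace satisfies a state formula iff its tail
satisfies the successor along the arcs that agree with the first letter. The decision trees that
generate the arcs (`Expands`) have exactly one leaf for each assignment, so every pair of moves
determines one successor. Hence synthesis is a reachability game on formulas, the targets being
those satisfied by the empty trace. Moreover, successors under the same letter of formulas with
propositionally equivalent next normal forms are again equivalent (`Step.propEquiv`), and whether
a formula is satisfied by the empty trace depends on its next normal form only.

*Equivalence checks.* Both checks compare a key of the formulas: the formula itself or its BDD.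
`Config.IsAdequate` collects what the search needs of the key: formulas with equal keys are
propositionally equivalent, and steps preserve equality of keys. For the syntactic check the second
condition is the uniqueness of successors; for BDDs both follow from the fact that the BDD over a
complete variable order determines, and is determined by, the Boolean function.

*Termination.* The nodes on a path have different keys. There are finitely many keys of state
formulas: with a size threshold because only finitely many Boolean combinations of the closure are
that small, and for BDDs because there are finitely many over a given order.

*Success.* A node is tagged as success only if no equivalent node is, and only by a move whose
successors all carry the tag (`Config.Justified`). Therefore a play that follows the recorded
strategy passes to ever older entries, until it reaches an accepting state.

*Failure.* The failure tags alone do not support an induction, because `backProp` also removes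
sound tags, on which decisions made earlier on the path may rest. The invariant `Config.Inv`
therefore speaks of a larger set of failing nodes, which only grows during a call: for each or-arc
of its members, some successor belongs to the set or is a node on the path at which a loop was
found.
When such a path node turns out to be a success, the nodes known before its call stay in the set,
since they cannot depend on it, and of the others those that are not its ancestors stay
(`Config.IsAdequate.inv_backProp`). At the end the path is empty, so that the environment can stay
among the failing nodes forever, and these are not accepting.
-/

namespace LTLfSynthesis

universe u v w

/-! ### Progression of formulas through one letter -/

namespace LTLf

variable {P : Type u}

theorem sat_cons_succ (σ : Set P) (ρ : List (Set P)) (ψ : LTLf P) :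
    ∀ i, Sat (σ :: ρ) ψ (i + 1) ↔ Sat ρ ψ i := by
  induction ψ with
  | tt => simp [Sat]
  | ff => simp [Sat]
  | atom p => simp [Sat]
  | natom p => simp [Sat]
  | and a b iha ihb => simp [Sat, iha, ihb]
  | or a b iha ihb => simp [Sat, iha, ihb]
  | next a ih => simp [Sat, ih]
  | wnext a ih => simp [Sat, ih]
  | untl a b iha ihb =>
    intro i
    constructor
    · rintro ⟨_ | j, hij, hj, hb, ha⟩
      · omega
      · exact ⟨j, by omega, by simpa using hj, (ihb j).1 hb,
          fun k hk hkj => (iha k).1 (ha (k + 1) (by omega) (by omega))⟩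
    · rintro ⟨j, hij, hj, hb, ha⟩
      refine ⟨j + 1, by omega, by simpa using hj, (ihb j).2 hb, ?_⟩
      rintro (_ | k) hk hkj
      · omega
      · exact (iha k).2 (ha k (by omega) (by omega))
  | rel a b iha ihb =>
    intro i
    constructor
    · intro h j hij hj
      rcases h (j + 1) (by omega) (by simpa using hj) with hb | ⟨_ | k, hk, hkj, ha⟩
      · exact .inl ((ihb j).1 hb)
      · omega
      · exact .inr ⟨k, by omega, by omega, (iha k).1 ha⟩
    · rintro h (_ | j) hij hj
      · omega
      · rcases h j (by omega) (by simpa using hj) with hb | ⟨k, hk, hkj, ha⟩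
        · exact .inl ((ihb j).2 hb)
        · exact .inr ⟨k + 1, by omega, by omega, (iha k).2 ha⟩

theorem xnf_untl (a b : LTLf P) : (a = tt ∧ b = tt) ∨
    (untl a b).xnf = or (and b.xnf evTrue) (and a.xnf (next (untl a b))) := by
  cases a <;> cases b <;> first | exact .inr rfl | exact .inl ⟨rfl, rfl⟩

theorem xnf_rel (a b : LTLf P) : (a = ff ∧ b = ff) ∨
    (rel a b).xnf = and (or b.xnf alwFalse) (or a.xnf (wnext (rel a b))) := by
  cases a <;> cases b <;> first | exact .inr rfl | exact .inl ⟨rfl, rfl⟩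

/-- The propositional variables are true at the head of a trace according to its first letter,
and those for temporal formulas according to what `rmNext` makes of them on the tail. -/
theorem models_cons_iff (σ : Set P) (ρ : List (Set P)) (ψ : LTLf P) (s : P → Bool)
    (z : LTLf P → Bool) (hs : ∀ p, s p = true ↔ p ∈ σ)
    (hz : ∀ α, z α = true ↔ Models ρ (PForm.st α).rmNext) :
    ψ.xnf.prop.eval s z = true ↔ Models (σ :: ρ) ψ := by
  have hev : z evTrue = true := (hz _).2 (by simp [PForm.rmNext, Models, Sat])
  have halw : z alwFalse = false := by
    have := hz alwFalse
    simpa [PForm.rmNext, Models, Sat] using this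
  have hnext : ∀ θ, z (next θ) = true ↔ 0 < ρ.length ∧ Sat ρ θ 0 := by
    intro θ
    rw [hz]
    simp only [PForm.rmNext, Models, Sat]
    constructor
    · rintro ⟨h, j, -, hj, -⟩
      exact ⟨by omega, h⟩
    · rintro ⟨h, h'⟩
      exact ⟨h', 0, le_rfl, h, trivial, fun _ _ _ => trivial⟩
  have hwnext : ∀ θ, z (wnext θ) = true ↔ (0 < ρ.length → Sat ρ θ 0) := by
    intro θ
    rw [hz]
    simp only [PForm.rmNext, Models, Sat]
    constructor
    · rintro (h | h) h'
      · exact h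
      · rcases h 0 le_rfl h' with h | ⟨_, _, _, h⟩ <;> exact h.elim
    · intro h
      by_cases h' : 0 < ρ.length
      · exact .inl (h h')
      · exact .inr fun j _ hj => absurd hj (by omega)
  unfold Models
  induction ψ with
  | tt => simp [xnf, prop, PForm.eval, Sat]
  | ff => simp [xnf, prop, PForm.eval, Sat]
  | atom p => simp [xnf, prop, PForm.eval, Sat, hs]
  | natom p => simp [xnf, prop, PForm.eval, Sat, ← hs]
  | and a b iha ihb => simp [xnf, prop, PForm.eval, Sat, iha, ihb]
  | or a b iha ihb => simp [xnf, prop, PForm.eval, Sat, iha, ihb]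
  | next a => simp [xnf, prop, PForm.eval, Sat, hnext, sat_cons_succ σ ρ a 0]
  | wnext a => simp [xnf, prop, PForm.eval, Sat, hwnext, sat_cons_succ σ ρ a 0]
  | untl a b iha ihb =>
    rcases xnf_untl a b with ⟨rfl, rfl⟩ | h
    · simp only [xnf, prop, PForm.eval, hev, true_iff]
      exact ⟨0, le_rfl, by simp, trivial, fun _ _ _ => trivial⟩
    · simp only [h, prop, PForm.eval, hev, Bool.and_true, Bool.or_eq_true, Bool.and_eq_true,
        iha, ihb, hnext]
      constructor
      · rintro (hb | ⟨ha, -, j, -, hj, hb, h⟩)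
        · exact ⟨0, le_rfl, by simp, hb, fun k _ hk => absurd hk (by omega)⟩
        · refine ⟨j + 1, by omega, by simpa using hj, (sat_cons_succ σ ρ b j).2 hb, ?_⟩
          rintro (_ | k) - hk
          · exact ha
          · exact (sat_cons_succ σ ρ a k).2 (h k (by omega) (by omega))
      · rintro ⟨_ | j, -, hj, hb, h⟩
        · exact .inl hb
        · simp only [List.length_cons, Nat.add_lt_add_iff_right] at hj
          exact .inr ⟨h 0 le_rfl (by omega), by omega, j, by omega, hj,
            (sat_cons_succ σ ρ b j).1 hb, fun k _ hk =>
              (sat_cons_succ σ ρ a k).1 (h (k + 1) (by omega) (by omega))⟩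
  | rel a b iha ihb =>
    rcases xnf_rel a b with ⟨rfl, rfl⟩ | h
    · simp only [xnf, prop, PForm.eval, halw, Bool.false_eq_true, false_iff]
      intro h
      rcases h 0 le_rfl (by simp) with h | ⟨_, _, _, h⟩ <;> exact h.elim
    · simp only [h, prop, PForm.eval, halw, Bool.or_false, Bool.or_eq_true, Bool.and_eq_true,
        iha, ihb, hwnext]
      constructor
      · rintro ⟨hb, ha⟩ (_ | j) - hj
        · exact .inl hb
        · simp only [List.length_cons, Nat.add_lt_add_iff_right] at hj
          rcases ha with ha | ha
          · exact .inr ⟨0, le_rfl, by omega, ha⟩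
          · rcases ha (by omega) j (by omega) hj with h | ⟨k, _, hk, h⟩
            · exact .inl ((sat_cons_succ σ ρ b j).2 h)
            · exact .inr ⟨k + 1, by omega, by omega, (sat_cons_succ σ ρ a k).2 h⟩
      · intro h
        refine ⟨?_, ?_⟩
        · rcases h 0 le_rfl (by simp) with h | ⟨k, _, hk, _⟩
          · exact h
          · omega
        · by_cases ha : Sat (σ :: ρ) a 0
          · exact .inl ha
          · refine .inr fun _ j _ hj => ?_
            rcases h (j + 1) (by omega) (by simpa using hj) with h | ⟨_ | k, _, hk, h⟩
            · exact .inl ((sat_cons_succ σ ρ b j).1 h)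
            · exact absurd h ha
            · exact .inr ⟨k, by omega, by omega, (sat_cons_succ σ ρ a k).1 h⟩

/-- Whether the empty trace satisfies a formula depends on its next normal form only: on the empty
trace, literals and temporal formulas behave as independent variables. -/
theorem evalPa_xnf_isAccepting (ψ : LTLf P) :
    ψ.xnf.prop.evalPa isAccepting = ψ.isAccepting := by
  induction ψ with
  | untl a b iha ihb =>
    rcases xnf_untl a b with ⟨rfl, rfl⟩ | h
    · rfl
    · simp [h, prop, PForm.evalPa, isAccepting]
  | rel a b iha ihb =>
    rcases xnf_rel a b with ⟨rfl, rfl⟩ | h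
    · rfl
    · simp [h, prop, PForm.evalPa, isAccepting]
  | _ => simp_all [xnf, prop, PForm.evalPa, isAccepting]

theorem evalPa_prop_congr (ψ : LTLf P) {C D : LTLf P → Bool} (h : ∀ α ∈ ψ.pa, C α = D α) :
    ψ.prop.evalPa C = ψ.prop.evalPa D := by
  induction ψ with
  | and a b iha ihb =>
    simp only [pa, List.mem_append] at h
    simp [prop, PForm.evalPa, iha fun α hα => h α (.inl hα), ihb fun α hα => h α (.inr hα)]
  | or a b iha ihb =>
    simp only [pa, List.mem_append] at h
    simp [prop, PForm.evalPa, iha fun α hα => h α (.inl hα), ihb fun α hα => h α (.inr hα)]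
  | _ => simp_all [prop, PForm.evalPa, pa]

/-- Propositional equivalence of the next normal forms, where the literals and the temporal
formulas count as independent variables. -/
def PropEquiv (ψ₁ ψ₂ : LTLf P) : Prop :=
  ∀ C, ψ₁.xnf.prop.evalPa C = ψ₂.xnf.prop.evalPa C

theorem PropEquiv.isAccepting_eq {ψ₁ ψ₂ : LTLf P} (h : PropEquiv ψ₁ ψ₂) :
    ψ₁.isAccepting = ψ₂.isAccepting := by
  rw [← evalPa_xnf_isAccepting, ← evalPa_xnf_isAccepting, h]

/-! ### State formulas -/

theorem self_mem_subformulas (ψ : LTLf P) : ψ ∈ ψ.subformulas := by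
  cases ψ <;> simp [subformulas]

theorem subformulas_subset {ψ θ : LTLf P} (h : θ ∈ ψ.subformulas) :
    θ.subformulas ⊆ ψ.subformulas := by
  induction ψ with
  | tt | ff | atom | natom =>
    simp only [subformulas, List.mem_singleton] at h
    subst h
    exact fun _ h => h
  | next a ih | wnext a ih =>
    simp only [subformulas, List.mem_cons] at h
    rcases h with rfl | h
    · exact fun _ h => h
    · exact fun x hx => List.mem_cons_of_mem _ (ih h hx)
  | and a b iha ihb | or a b iha ihb | untl a b iha ihb | rel a b iha ihb =>
    simp only [subformulas, List.mem_cons, List.mem_append] at h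
    rcases h with rfl | h | h
    · exact fun _ h => h
    · exact fun x hx => List.mem_cons_of_mem _ (List.mem_append_left _ (iha h hx))
    · exact fun x hx => List.mem_cons_of_mem _ (List.mem_append_right _ (ihb h hx))

theorem subformulas_subset_cl {φ θ : LTLf P} (h : θ ∈ φ.cl) : θ.subformulas ⊆ φ.cl := by
  simp only [cl, List.mem_append] at h
  intro x hx
  simp only [cl, List.mem_append]
  rcases h with (h | h) | h
  · exact .inl (.inl (subformulas_subset h hx))
  · exact .inl (.inr (subformulas_subset h hx))
  · exact .inr (subformulas_subset h hx)

theorem self_mem_cl (φ : LTLf P) : φ ∈ φ.cl := by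
  simp [cl, self_mem_subformulas φ]

theorem evTrue_mem_cl (φ : LTLf P) : evTrue ∈ φ.cl := by
  simp [cl, subformulas]

theorem alwFalse_mem_cl (φ : LTLf P) : alwFalse ∈ φ.cl := by
  simp [cl, subformulas]

/-- Boolean combinations of elements of `cl φ`. All OR-nodes of the search graph of `φ` are of
this form. -/
inductive BoolComb (φ : LTLf P) : LTLf P → Prop
  | base {θ : LTLf P} : θ ∈ φ.cl → BoolComb φ θ
  | tt : BoolComb φ tt
  | ff : BoolComb φ ff
  | and {a b : LTLf P} : BoolComb φ a → BoolComb φ b → BoolComb φ (and a b)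
  | or {a b : LTLf P} : BoolComb φ a → BoolComb φ b → BoolComb φ (or a b)

/-- This bounds the nodes of the search with a size threshold. It needs no finiteness of the sets of
variables. -/
theorem finite_boolComb_size_le (φ : LTLf P) (t : ℕ) :
    {ψ | BoolComb φ ψ ∧ ψ.size ≤ t}.Finite := by
  induction t with
  | zero =>
    refine Set.finite_empty.subset ?_
    rintro ψ ⟨-, h⟩
    cases ψ <;> simp [size] at h
  | succ t ih =>
    refine ((((List.finite_toSet φ.cl).union (Set.toFinite {LTLf.tt, LTLf.ff})).union
      (Set.Finite.image2 LTLf.and ih ih)).union (Set.Finite.image2 LTLf.or ih ih)).subset ?_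
    rintro ψ ⟨h, hs⟩
    cases h with
    | base h => exact .inl (.inl (.inl h))
    | tt => simp
    | ff => simp
    | and ha hb =>
      simp only [size] at hs
      exact .inl (.inr ⟨_, ⟨ha, by omega⟩, _, ⟨hb, by omega⟩, rfl⟩)
    | or ha hb =>
      simp only [size] at hs
      exact .inr ⟨_, ⟨ha, by omega⟩, _, ⟨hb, by omega⟩, rfl⟩

/-- The temporal formulas whose variables occur in the propositionalized next normal forms of
state formulas of `φ`. -/
def stepAtoms (φ : LTLf P) : Set (LTLf P) :=
  {α | α = evTrue ∨ α = alwFalse ∨ ∃ θ ∈ φ.cl, α = next θ ∨ α = wnext θ}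

theorem states_xnf_of_mem_cl {φ : LTLf P} (ψ : LTLf P) (h : ψ ∈ φ.cl) :
    ψ.xnf.prop.states ⊆ stepAtoms φ := by
  have hev : evTrue ∈ stepAtoms φ := .inl rfl
  have halw : alwFalse ∈ stepAtoms φ := .inr (.inl rfl)
  induction ψ with
  | tt | ff | atom | natom => simp [xnf, prop, PForm.states]
  | and a b iha ihb | or a b iha ihb =>
    have := subformulas_subset_cl h
    exact Set.union_subset
      (iha (this (by simp [subformulas, self_mem_subformulas])))
      (ihb (this (by simp [subformulas, self_mem_subformulas])))
  | next a =>
    have := subformulas_subset_cl h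
    exact Set.singleton_subset_iff.2 (.inr (.inr ⟨a, this (by
      simp [subformulas, self_mem_subformulas]), .inl rfl⟩))
  | wnext a =>
    have := subformulas_subset_cl h
    exact Set.singleton_subset_iff.2 (.inr (.inr ⟨a, this (by
      simp [subformulas, self_mem_subformulas]), .inr rfl⟩))
  | untl a b iha ihb =>
    have hs := subformulas_subset_cl h
    rcases xnf_untl a b with ⟨rfl, rfl⟩ | he
    · exact Set.singleton_subset_iff.2 hev
    · rw [he]
      exact Set.union_subset (Set.union_subset
        (ihb (hs (by simp [subformulas, self_mem_subformulas]))) (Set.singleton_subset_iff.2 hev))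
        (Set.union_subset (iha (hs (by simp [subformulas, self_mem_subformulas])))
          (Set.singleton_subset_iff.2 (.inr (.inr ⟨_, h, .inl rfl⟩))))
  | rel a b iha ihb =>
    have hs := subformulas_subset_cl h
    rcases xnf_rel a b with ⟨rfl, rfl⟩ | he
    · exact Set.singleton_subset_iff.2 halw
    · rw [he]
      exact Set.union_subset (Set.union_subset
        (ihb (hs (by simp [subformulas, self_mem_subformulas]))) (Set.singleton_subset_iff.2 halw))
        (Set.union_subset (iha (hs (by simp [subformulas, self_mem_subformulas])))
          (Set.singleton_subset_iff.2 (.inr (.inr ⟨_, h, .inr rfl⟩))))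

theorem BoolComb.states_xnf {φ ψ : LTLf P} (h : BoolComb φ ψ) :
    ψ.xnf.prop.states ⊆ stepAtoms φ := by
  induction h with
  | base h => exact states_xnf_of_mem_cl _ h
  | tt => simp [xnf, prop, PForm.states]
  | ff => simp [xnf, prop, PForm.states]
  | and _ _ iha ihb => exact Set.union_subset iha ihb
  | or _ _ iha ihb => exact Set.union_subset iha ihb

end LTLf

namespace PForm

variable {P : Type u}

/-- The formula of an AND-node is already in next normal form. -/
theorem xnf_prop_tf {φ : LTLf P} (f : PForm P) (h : f.states ⊆ φ.stepAtoms) :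
    f.tf.xnf.prop = f := by
  induction f with
  | tt | ff | pos | neg => rfl
  | st α =>
    rcases Set.singleton_subset_iff.1 h with rfl | rfl | ⟨θ, -, rfl | rfl⟩ <;> rfl
  | and a b iha ihb | or a b iha ihb =>
    have := Set.union_subset_iff.1 h
    simp [tf, LTLf.xnf, LTLf.prop, iha this.1, ihb this.2]

/-- Classical valuations are among those that treat `p` and its negation as separate variables;
hence propositional equivalence over `pa` implies classical equivalence. -/
theorem eval_eq_evalPa {φ : LTLf P} (f : PForm P) (h : f.states ⊆ φ.stepAtoms)
    (σ : P → Bool) (z : LTLf P → Bool) :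
    f.eval σ z = f.evalPa fun
      | .atom p => σ p
      | .natom p => !σ p
      | α => z α := by
  induction f with
  | tt | ff | pos | neg => rfl
  | st α =>
    rcases Set.singleton_subset_iff.1 h with rfl | rfl | ⟨θ, -, rfl | rfl⟩ <;> rfl
  | and a b iha ihb | or a b iha ihb =>
    have := Set.union_subset_iff.1 h
    simp [eval, evalPa, iha this.1, ihb this.2]

variable [DecidableEq P]

theorem boolComb_rmNext {φ : LTLf P} (f : PForm P) (h : f.states ⊆ φ.stepAtoms)
    (hv : f.vars = ∅) : φ.BoolComb f.rmNext := by
  induction f with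
  | tt => exact .tt
  | ff => exact .ff
  | pos | neg => simp [vars] at hv
  | st α =>
    rcases Set.singleton_subset_iff.1 h with rfl | rfl | ⟨θ, hθ, rfl | rfl⟩
    · exact .tt
    · exact .ff
    · exact .and (.base hθ) (.base φ.evTrue_mem_cl)
    · exact .or (.base hθ) (.base φ.alwFalse_mem_cl)
  | and a b iha ihb =>
    have := Set.union_subset_iff.1 h
    have hv := Finset.union_eq_empty.1 hv
    exact .and (iha this.1 hv.1) (ihb this.2 hv.2)
  | or a b iha ihb =>
    have := Set.union_subset_iff.1 h
    have hv := Finset.union_eq_empty.1 hv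
    exact .or (iha this.1 hv.1) (ihb this.2 hv.2)

theorem evalPa_xnf_rmNext (f : PForm P) (hv : f.vars = ∅) (C : LTLf P → Bool) (σ : P → Bool) :
    f.rmNext.xnf.prop.evalPa C =
      f.eval σ fun α => (st α).rmNext.xnf.prop.evalPa C := by
  induction f with
  | tt | ff | st => rfl
  | pos | neg => simp [vars] at hv
  | and a b iha ihb | or a b iha ihb =>
    have hv := Finset.union_eq_empty.1 hv
    simp [rmNext, LTLf.xnf, LTLf.prop, evalPa, eval, iha hv.1, ihb hv.2]

theorem models_rmNext_iff (f : PForm P) (hv : f.vars = ∅) (ρ : List (Set P)) (σ : P → Bool)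
    (z : LTLf P → Bool) (hz : ∀ α, z α = true ↔ LTLf.Models ρ (st α).rmNext) :
    LTLf.Models ρ f.rmNext ↔ f.eval σ z = true := by
  unfold LTLf.Models at *
  induction f with
  | tt | ff => simp [rmNext, tf, LTLf.Sat, eval]
  | st α => simp [eval, hz]
  | pos | neg => simp [vars] at hv
  | and a b iha ihb | or a b iha ihb =>
    have hv := Finset.union_eq_empty.1 hv
    simp [rmNext, LTLf.Sat, eval, iha hv.1, ihb hv.2]

end PForm

/-! ### Decision trees and the arcs of the search graph -/

section DecisionTrees

variable {P : Type u} [DecidableEq P] {V : Type v}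

/-- `Expands ι R f L`: the list `L` of pairs (path, remaining formula) is read off from the leaves
of a decision tree for `f` that branches on the variables in the range of `ι` until none of them
occurs. -/
inductive Expands (ι : V → P) (R : Replacement P) : PForm P → List (Move V × PForm P) → Prop
  | leaf {f : PForm P} : (∀ v, ι v ∉ f.vars) → Expands ι R f [([], f)]
  | branch {f : PForm P} {v : V} {b : Bool} {L₁ L₂ : List (Move V × PForm P)} : ι v ∈ f.vars →
      Expands ι R (R.replace f (ι v, b)) L₁ → Expands ι R (R.replace f (ι v, !b)) L₂ →
      Expands ι R f (L₁.map (fun p => ((v, b) :: p.1, p.2)) ++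
        L₂.map (fun p => ((v, !b) :: p.1, p.2)))

namespace Expands

variable {ι : V → P} {R : Replacement P} {f : PForm P} {L : List (Move V × PForm P)}

theorem vars_subset (h : Expands ι R f L) {p : Move V × PForm P} (hp : p ∈ L) :
    p.2.vars ⊆ f.vars := by
  induction h generalizing p with
  | leaf => simp_all
  | branch hv _ _ ih₁ ih₂ =>
    simp only [List.mem_append, List.mem_map] at hp
    rcases hp with ⟨q, hq, rfl⟩ | ⟨q, hq, rfl⟩
    · exact (ih₁ hq).trans ((R.vars_replace _ _).trans (Finset.erase_subset _ _))
    · exact (ih₂ hq).trans ((R.vars_replace _ _).trans (Finset.erase_subset _ _))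

theorem states_subset (h : Expands ι R f L) {p : Move V × PForm P} (hp : p ∈ L) :
    p.2.states ⊆ f.states := by
  induction h generalizing p with
  | leaf => simp_all
  | branch hv _ _ ih₁ ih₂ =>
    simp only [List.mem_append, List.mem_map] at hp
    rcases hp with ⟨q, hq, rfl⟩ | ⟨q, hq, rfl⟩
    · exact (ih₁ hq).trans (R.states_replace _ _)
    · exact (ih₂ hq).trans (R.states_replace _ _)

theorem not_mem_vars (h : Expands ι R f L) {p : Move V × PForm P} (hp : p ∈ L) (v : V) :
    ι v ∉ p.2.vars := by
  induction h generalizing p with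
  | leaf => simp_all
  | branch hv _ _ ih₁ ih₂ =>
    simp only [List.mem_append, List.mem_map] at hp
    rcases hp with ⟨q, hq, rfl⟩ | ⟨q, hq, rfl⟩
    · exact ih₁ (p := q) hq
    · exact ih₂ (p := q) hq

theorem move_vars (h : Expands ι R f L) {p : Move V × PForm P} (hp : p ∈ L) :
    ∀ l ∈ p.1, ι l.1 ∈ f.vars := by
  induction h generalizing p with
  | leaf => simp_all
  | branch hv _ _ ih₁ ih₂ =>
    simp only [List.mem_append, List.mem_map] at hp
    rcases hp with ⟨q, hq, rfl⟩ | ⟨q, hq, rfl⟩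
    · simp only [List.mem_cons, forall_eq_or_imp]
      exact ⟨hv, fun l hl => Finset.mem_of_mem_erase (R.vars_replace _ _ (ih₁ hq l hl))⟩
    · simp only [List.mem_cons, forall_eq_or_imp]
      exact ⟨hv, fun l hl => Finset.mem_of_mem_erase (R.vars_replace _ _ (ih₂ hq l hl))⟩

/-- No variable is branched on twice on a path. -/
theorem nodup_move (h : Expands ι R f L) {p : Move V × PForm P} (hp : p ∈ L) :
    (p.1.map Prod.fst).Nodup := by
  induction h generalizing p with
  | leaf => simp_all
  | branch hv h₁ h₂ ih₁ ih₂ =>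
    simp only [List.mem_append, List.mem_map] at hp
    rcases hp with ⟨q, hq, rfl⟩ | ⟨q, hq, rfl⟩
    · refine List.nodup_cons.2 ⟨fun hmem => ?_, ih₁ hq⟩
      obtain ⟨l, hl, he⟩ := List.mem_map.1 hmem
      have := R.vars_replace _ _ (h₁.move_vars hq l hl)
      simp_all
    · refine List.nodup_cons.2 ⟨fun hmem => ?_, ih₂ hq⟩
      obtain ⟨l, hl, he⟩ := List.mem_map.1 hmem
      have := R.vars_replace _ _ (h₂.move_vars hq l hl)
      simp_all

theorem eval_eq (h : Expands ι R f L) {p : Move V × PForm P} (hp : p ∈ L) (σ : P → Bool)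
    (z : LTLf P → Bool) (hσ : ∀ l ∈ p.1, σ (ι l.1) = l.2) : p.2.eval σ z = f.eval σ z := by
  induction h generalizing p with
  | leaf => simp_all
  | branch hv _ _ ih₁ ih₂ =>
    simp only [List.mem_append, List.mem_map] at hp
    rcases hp with ⟨q, hq, rfl⟩ | ⟨q, hq, rfl⟩
    · simp only [List.mem_cons, forall_eq_or_imp] at hσ
      rw [ih₁ hq hσ.2, R.eval_replace, ← hσ.1, Function.update_eq_self]
    · simp only [List.mem_cons, forall_eq_or_imp] at hσ
      rw [ih₂ hq hσ.2, R.eval_replace, ← hσ.1, Function.update_eq_self]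

theorem exists_agrees (h : Expands ι R f L) (S : Set V) : ∃ p ∈ L, Agrees S p.1 := by
  classical
  induction h with
  | leaf => exact ⟨_, List.mem_singleton_self _, by simp [Agrees]⟩
  | @branch f v b L₁ L₂ hv _ _ ih₁ ih₂ =>
    obtain ⟨p, hp, hpa⟩ := ih₁
    obtain ⟨q, hq, hqa⟩ := ih₂
    by_cases hb : v ∈ S ↔ b = true
    · refine ⟨((v, b) :: p.1, p.2), by simp [hp], ?_⟩
      simp only [Agrees, List.mem_cons, forall_eq_or_imp]
      exact ⟨hb, hpa⟩
    · refine ⟨((v, !b) :: q.1, q.2), by simp [hq], ?_⟩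
      simp only [Agrees, List.mem_cons, forall_eq_or_imp]
      refine ⟨?_, hqa⟩
      cases b <;> simp_all

theorem agrees_unique (h : Expands ι R f L) {S : Set V} {p q : Move V × PForm P} (hp : p ∈ L)
    (hq : q ∈ L) (hpS : Agrees S p.1) (hqS : Agrees S q.1) : p = q := by
  induction h generalizing p q with
  | leaf => simp_all
  | @branch f v b L₁ L₂ hv _ _ ih₁ ih₂ =>
    simp only [List.mem_append, List.mem_map] at hp hq
    rcases hp with ⟨p, hp, rfl⟩ | ⟨p, hp, rfl⟩ <;> rcases hq with ⟨q, hq, rfl⟩ | ⟨q, hq, rfl⟩ <;>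
      simp only [Agrees, List.mem_cons, forall_eq_or_imp] at hpS hqS
    · rw [ih₁ hp hq hpS.2 hqS.2]
    · have := hpS.1.symm.trans hqS.1
      cases b <;> simp at this
    · have := hpS.1.symm.trans hqS.1
      cases b <;> simp at this
    · rw [ih₂ hp hq hpS.2 hqS.2]

end Expands

theorem exists_agrees_of_nodup (act : Move V) (h : (act.map Prod.fst).Nodup) :
    ∃ S, Agrees S act := by
  refine ⟨{v | (v, true) ∈ act}, ?_⟩
  rintro ⟨v, b⟩ hl
  cases b
  · simp only [Set.mem_ofPred_eq, Bool.false_eq_true, iff_false]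
    intro h'
    simpa using List.inj_on_of_nodup_map h hl h' rfl
  · simpa using hl

end DecisionTrees

section Arcs

variable {X : Type u} {Y : Type v} [DecidableEq X] [DecidableEq Y]
  (B : Branching X Y) (R : Replacement (X ⊕ Y))

theorem exists_expands_or (f : PForm (X ⊕ Y)) (ass : Move Y) :
    ∃ L, Expands Sum.inr R f L ∧
      dpllGetOrArcs B R f ass = L.map fun p => (ass ++ p.1, p.2.tf) := by
  induction hn : f.agentVars.card using Nat.strong_induction_on generalizing f ass with
  | _ n ih =>
    subst hn
    rw [dpllGetOrArcs]
    split_ifs with h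
    · have hy := (B.agent f h).1.2
      obtain ⟨L₁, h₁, e₁⟩ := ih _ (card_agentVars_replace_lt R f _ hy (B.agent f h).2) _
        (ass ++ [((B.agent f h).1.1, (B.agent f h).2)]) rfl
      obtain ⟨L₂, h₂, e₂⟩ := ih _ (card_agentVars_replace_lt R f _ hy (!(B.agent f h).2)) _
        (ass ++ [((B.agent f h).1.1, !(B.agent f h).2)]) rfl
      refine ⟨_, .branch (Finset.mem_toRight.1 hy) h₁ h₂, ?_⟩
      simp [e₁, e₂, Function.comp_def]
    · refine ⟨_, .leaf fun v hv => h ⟨v, Finset.mem_toRight.2 hv⟩, by simp⟩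

theorem exists_expands_and (f : PForm (X ⊕ Y)) (ass : Move X) :
    ∃ L, Expands Sum.inl R f L ∧
      dpllGetAndArcs B R f ass = L.map fun p => (ass ++ p.1, p.2.rmNext) := by
  induction hn : f.envVars.card using Nat.strong_induction_on generalizing f ass with
  | _ n ih =>
    subst hn
    rw [dpllGetAndArcs]
    split_ifs with h
    · have hy := (B.env f h).1.2
      obtain ⟨L₁, h₁, e₁⟩ := ih _ (card_envVars_replace_lt R f _ hy (B.env f h).2) _
        (ass ++ [((B.env f h).1.1, (B.env f h).2)]) rfl
      obtain ⟨L₂, h₂, e₂⟩ := ih _ (card_envVars_replace_lt R f _ hy (!(B.env f h).2)) _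
        (ass ++ [((B.env f h).1.1, !(B.env f h).2)]) rfl
      refine ⟨_, .branch (Finset.mem_toLeft.1 hy) h₁ h₂, ?_⟩
      simp [e₁, e₂, Function.comp_def]
    · refine ⟨_, .leaf fun v hv => h ⟨v, Finset.mem_toLeft.2 hv⟩, by simp⟩

theorem exists_orArc (ψ : LTLf (X ⊕ Y)) (S : Set Y) : ∃ o ∈ orArcs B R ψ, Agrees S o.1 := by
  obtain ⟨L, h, e⟩ := exists_expands_or B R ψ.xnf.prop []
  obtain ⟨p, hp, ha⟩ := h.exists_agrees S
  exact ⟨(p.1, p.2.tf), by rw [orArcs, e]; exact List.mem_map.2 ⟨p, hp, rfl⟩, ha⟩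

theorem exists_andArc (m : LTLf (X ⊕ Y)) (S : Set X) : ∃ a ∈ andArcs B R m, Agrees S a.1 := by
  obtain ⟨L, h, e⟩ := exists_expands_and B R m.xnf.prop []
  obtain ⟨p, hp, ha⟩ := h.exists_agrees S
  exact ⟨(p.1, p.2.rmNext), by rw [andArcs, e]; exact List.mem_map.2 ⟨p, hp, rfl⟩, ha⟩

variable {B R}

theorem orArc_unique {ψ : LTLf (X ⊕ Y)} {S : Set Y} {o o' : Move Y × LTLf (X ⊕ Y)}
    (ho : o ∈ orArcs B R ψ) (ho' : o' ∈ orArcs B R ψ) (h : Agrees S o.1) (h' : Agrees S o'.1) :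
    o = o' := by
  obtain ⟨L, hL, e⟩ := exists_expands_or B R ψ.xnf.prop []
  rw [orArcs, e] at ho ho'
  obtain ⟨p, hp, rfl⟩ := List.mem_map.1 ho
  obtain ⟨q, hq, rfl⟩ := List.mem_map.1 ho'
  rw [hL.agrees_unique hp hq h h']

theorem andArc_unique {m : LTLf (X ⊕ Y)} {S : Set X} {a a' : Move X × LTLf (X ⊕ Y)}
    (ha : a ∈ andArcs B R m) (ha' : a' ∈ andArcs B R m) (h : Agrees S a.1)
    (h' : Agrees S a'.1) : a = a' := by
  obtain ⟨L, hL, e⟩ := exists_expands_and B R m.xnf.prop []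
  rw [andArcs, e] at ha ha'
  obtain ⟨p, hp, rfl⟩ := List.mem_map.1 ha
  obtain ⟨q, hq, rfl⟩ := List.mem_map.1 ha'
  rw [hL.agrees_unique hp hq h h']

theorem orArc_consistent {ψ : LTLf (X ⊕ Y)} {o : Move Y × LTLf (X ⊕ Y)}
    (ho : o ∈ orArcs B R ψ) : ∃ S, Agrees S o.1 := by
  obtain ⟨L, hL, e⟩ := exists_expands_or B R ψ.xnf.prop []
  rw [orArcs, e] at ho
  obtain ⟨p, hp, rfl⟩ := List.mem_map.1 ho
  exact exists_agrees_of_nodup _ (hL.nodup_move hp)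

theorem andArc_consistent {m : LTLf (X ⊕ Y)} {a : Move X × LTLf (X ⊕ Y)}
    (ha : a ∈ andArcs B R m) : ∃ S, Agrees S a.1 := by
  obtain ⟨L, hL, e⟩ := exists_expands_and B R m.xnf.prop []
  rw [andArcs, e] at ha
  obtain ⟨p, hp, rfl⟩ := List.mem_map.1 ha
  exact exists_agrees_of_nodup _ (hL.nodup_move hp)

/-- A successor is obtained by `rmNext` from a propositional formula without variables whose value
is that of the next normal form under any letter that agrees with the two moves. -/
theorem exists_rmNext_eq {φ ψ : LTLf (X ⊕ Y)} (hψ : φ.BoolComb ψ)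
    {o : Move Y × LTLf (X ⊕ Y)} (ho : o ∈ orArcs B R ψ) {a : Move X × LTLf (X ⊕ Y)}
    (ha : a ∈ andArcs B R o.2) :
    ∃ f : PForm (X ⊕ Y), a.2 = f.rmNext ∧ f.vars = ∅ ∧ f.states ⊆ φ.stepAtoms ∧
      ∀ (S : Set Y) (T : Set X) (σ : X ⊕ Y → Bool) (z : LTLf (X ⊕ Y) → Bool), Agrees S o.1 →
        Agrees T a.1 → (∀ p, σ p = true ↔ p ∈ letter T S) →
        f.eval σ z = ψ.xnf.prop.eval σ z := by
  obtain ⟨L, hL, e⟩ := exists_expands_or B R ψ.xnf.prop []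
  rw [orArcs, e] at ho
  obtain ⟨p, hp, rfl⟩ := List.mem_map.1 ho
  have hstates := (hL.states_subset hp).trans hψ.states_xnf
  obtain ⟨L', hL', e'⟩ := exists_expands_and B R p.2 []
  rw [andArcs, PForm.xnf_prop_tf _ hstates, e'] at ha
  obtain ⟨q, hq, rfl⟩ := List.mem_map.1 ha
  refine ⟨q.2, rfl, ?_, (hL'.states_subset hq).trans hstates, ?_⟩
  · refine Finset.eq_empty_of_forall_notMem ?_
    rintro (x | y) h
    · exact hL'.not_mem_vars hq x h
    · exact hL.not_mem_vars hp y (hL'.vars_subset hq h)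
  · intro S T σ z hS hT hσ
    rw [hL'.eval_eq hq, hL.eval_eq hp]
    · intro l hl
      have := hσ (Sum.inr l.1)
      have h2 := hS l (by simpa using hl)
      rw [Bool.eq_iff_iff, this, ← h2]
      simp [letter]
    · intro l hl
      have := hσ (Sum.inl l.1)
      have h2 := hT l (by simpa using hl)
      rw [Bool.eq_iff_iff, this, ← h2]
      simp [letter]

theorem boolComb_succ {φ ψ : LTLf (X ⊕ Y)} (hψ : φ.BoolComb ψ)
    {o : Move Y × LTLf (X ⊕ Y)} (ho : o ∈ orArcs B R ψ) {a : Move X × LTLf (X ⊕ Y)}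
    (ha : a ∈ andArcs B R o.2) : φ.BoolComb a.2 := by
  obtain ⟨f, e, hv, hs, -⟩ := exists_rmNext_eq hψ ho ha
  exact e ▸ PForm.boolComb_rmNext f hs hv

variable (B R) in
/-- `Step B R ψ S T ψ'`: the arcs of the search graph lead from the OR-node `ψ` to the OR-node
`ψ'` when the agent plays `S` and the environment plays `T`. -/
def Step (ψ : LTLf (X ⊕ Y)) (S : Set Y) (T : Set X) (ψ' : LTLf (X ⊕ Y)) : Prop :=
  ∃ o ∈ orArcs B R ψ, Agrees S o.1 ∧ ∃ a ∈ andArcs B R o.2, Agrees T a.1 ∧ a.2 = ψ'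

variable (B R) in
theorem exists_step (ψ : LTLf (X ⊕ Y)) (S : Set Y) (T : Set X) : ∃ ψ', Step B R ψ S T ψ' := by
  obtain ⟨o, ho, hS⟩ := exists_orArc B R ψ S
  obtain ⟨a, ha, hT⟩ := exists_andArc B R o.2 T
  exact ⟨a.2, o, ho, hS, a, ha, hT, rfl⟩

namespace Step

variable {φ ψ ψ₁ ψ₂ : LTLf (X ⊕ Y)} {S : Set Y} {T : Set X}

theorem unique (h₁ : Step B R ψ S T ψ₁) (h₂ : Step B R ψ S T ψ₂) : ψ₁ = ψ₂ := by
  obtain ⟨o, ho, hS, a, ha, hT, rfl⟩ := h₁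
  obtain ⟨o', ho', hS', a', ha', hT', rfl⟩ := h₂
  obtain rfl := orArc_unique ho ho' hS hS'
  rw [andArc_unique ha ha' hT hT']

theorem boolComb (h : Step B R ψ S T ψ₁) (hψ : φ.BoolComb ψ) : φ.BoolComb ψ₁ := by
  obtain ⟨o, ho, hS, a, ha, hT, rfl⟩ := h
  exact boolComb_succ hψ ho ha

theorem models_cons_iff (h : Step B R ψ S T ψ₁) (hψ : φ.BoolComb ψ)
    (ρ : List (Set (X ⊕ Y))) : LTLf.Models (letter T S :: ρ) ψ ↔ LTLf.Models ρ ψ₁ := by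
  classical
  obtain ⟨o, ho, hS, a, ha, hT, rfl⟩ := h
  obtain ⟨f, e, hv, hs, hf⟩ := exists_rmNext_eq hψ ho ha
  have hσ : ∀ p, decide (p ∈ letter T S) = true ↔ p ∈ letter T S := fun p => decide_eq_true_iff
  have hz : ∀ α : LTLf (X ⊕ Y), decide (LTLf.Models ρ (PForm.st α).rmNext) = true ↔
    LTLf.Models ρ (PForm.st α).rmNext := fun p => decide_eq_true_iff
  rw [← LTLf.models_cons_iff (letter T S) ρ ψ _ _ hσ hz, e, PForm.models_rmNext_iff f hv ρ _ _ hz,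
    hf S T _ _ hS hT hσ]

theorem propEquiv {ψ' ψ₁' : LTLf (X ⊕ Y)} (h : Step B R ψ S T ψ₁) (h' : Step B R ψ' S T ψ₁')
    (hψ : φ.BoolComb ψ) (hψ' : φ.BoolComb ψ') (he : ψ.PropEquiv ψ') : ψ₁.PropEquiv ψ₁' := by
  classical
  obtain ⟨o, ho, hS, a, ha, hT, rfl⟩ := h
  obtain ⟨o', ho', hS', a', ha', hT', rfl⟩ := h'
  obtain ⟨f, e, hv, hs, hf⟩ := exists_rmNext_eq hψ ho ha
  obtain ⟨f', e', hv', hs', hf'⟩ := exists_rmNext_eq hψ' ho' ha'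
  have hσ : ∀ p, decide (p ∈ letter T S) = true ↔ p ∈ letter T S := fun p => decide_eq_true_iff
  intro C
  rw [e, e', f.evalPa_xnf_rmNext hv C fun p => decide (p ∈ letter T S),
    f'.evalPa_xnf_rmNext hv' C fun p => decide (p ∈ letter T S), hf S T _ _ hS hT hσ,
    hf' S T _ _ hS' hT' hσ, PForm.eval_eq_evalPa _ hψ.states_xnf,
    PForm.eval_eq_evalPa _ hψ'.states_xnf, he]

end Step

end Arcs

/-! ### Dependence on the recursion bound -/

section Fuel

variable {X : Type u} {Y : Type v} [DecidableEq X] [DecidableEq Y]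

namespace Config

variable (c : Config X Y)

theorem andLoop_congr {f g : LTLf (X ⊕ Y) → SearchState X Y → Run (Bool × SearchState X Y)}
    (h : ∀ n s, f n s ≠ .outOfFuel → g n s = f n s) (arcs : List (Move X × LTLf (X ⊕ Y))) :
    ∀ s, c.andLoop f arcs s ≠ .outOfFuel → c.andLoop g arcs s = c.andLoop f arcs s := by
  induction arcs with
  | nil => intro s _; rfl
  | cons a arcs ih =>
    intro s hs
    obtain ⟨r, succ⟩ := a
    simp only [andLoop] at hs ⊢
    split_ifs at hs ⊢ with hb
    · rfl
    · have hf : f succ s ≠ .outOfFuel := fun e => hs (by rw [e])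
      rw [h succ s hf]
      rcases hr : f succ s with _ | _ | ⟨_ | _, s'⟩ <;> simp only [hr] at hs ⊢
      exact ih s' hs

theorem orLoop_congr {f g : LTLf (X ⊕ Y) → SearchState X Y → Run (Bool × SearchState X Y)}
    (h : ∀ n s, f n s ≠ .outOfFuel → g n s = f n s) (n : LTLf (X ⊕ Y))
    (arcs : List (Move Y × LTLf (X ⊕ Y))) :
    ∀ s, c.orLoop f n arcs s ≠ .outOfFuel → c.orLoop g n arcs s = c.orLoop f n arcs s := by
  induction arcs with
  | nil => intro s _; rfl
  | cons a arcs ih =>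
    intro s hs
    obtain ⟨act, m⟩ := a
    simp only [orLoop] at hs ⊢
    split_ifs at hs ⊢ with hb
    · rfl
    · have hf : c.andLoop f (andArcs c.branching c.repl m) s ≠ .outOfFuel :=
        fun e => hs (by rw [e])
      rw [c.andLoop_congr h _ s hf]
      rcases hr : c.andLoop f (andArcs c.branching c.repl m) s with _ | _ | ⟨_ | _, s'⟩ <;>
        simp only [hr] at hs ⊢
      exact ih s' hs

theorem search_succ_eq (fuel : ℕ) : ∀ n path s, c.search fuel n path s ≠ .outOfFuel →
    c.search (fuel + 1) n path s = c.search fuel n path s := by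
  induction fuel with
  | zero => intro n path s h; simp [search] at h
  | succ fuel ih =>
    intro n path s h
    rw [search] at h ⊢
    rw [search]
    split_ifs at h ⊢
    any_goals rfl
    exact c.orLoop_congr (fun m s => ih m (n :: path) s) _ _ _ h

theorem search_eq_of_le {N fuel : ℕ} (h : N ≤ fuel) {n path s}
    (hs : c.search N n path s ≠ .outOfFuel) : c.search fuel n path s = c.search N n path s := by
  induction fuel, h using Nat.le_induction with
  | base => rfl
  | succ k _ ih => rw [c.search_succ_eq k n path s (ih ▸ hs), ih]

theorem andLoop_ne_outOfFuel {f : LTLf (X ⊕ Y) → SearchState X Y → Run (Bool × SearchState X Y)}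
    (arcs : List (Move X × LTLf (X ⊕ Y)))
    (h : ∀ a ∈ arcs, c.tooBig a.2 = false → ∀ s, f a.2 s ≠ .outOfFuel) :
    ∀ s, c.andLoop f arcs s ≠ .outOfFuel := by
  induction arcs with
  | nil => intro s; simp [andLoop]
  | cons a arcs ih =>
    intro s
    obtain ⟨r, succ⟩ := a
    simp only [andLoop]
    split_ifs with hb
    · simp
    · have hf := h (r, succ) (by simp) (by simpa using hb) s
      rcases hr : f succ s with _ | _ | ⟨_ | _, s'⟩
      · exact absurd hr hf
      · simp
      · simp
      · exact ih (fun a ha => h a (List.mem_cons_of_mem _ ha)) s'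

theorem orLoop_ne_outOfFuel {f : LTLf (X ⊕ Y) → SearchState X Y → Run (Bool × SearchState X Y)}
    (n : LTLf (X ⊕ Y)) (arcs : List (Move Y × LTLf (X ⊕ Y)))
    (h : ∀ o ∈ arcs, ∀ a ∈ andArcs c.branching c.repl o.2, c.tooBig a.2 = false →
      ∀ s, f a.2 s ≠ .outOfFuel) :
    ∀ s, c.orLoop f n arcs s ≠ .outOfFuel := by
  induction arcs with
  | nil => intro s; simp [orLoop]
  | cons a arcs ih =>
    intro s
    obtain ⟨act, m⟩ := a
    simp only [orLoop]
    split_ifs with hb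
    · simp
    · have hf := c.andLoop_ne_outOfFuel _ (h (act, m) (by simp)) s
      rcases hr : c.andLoop f (andArcs c.branching c.repl m) s with _ | _ | ⟨_ | _, s'⟩
      · exact absurd hr hf
      · simp
      · exact ih (fun o ho => h o (List.mem_cons_of_mem _ ho)) s'
      · simp

theorem andLoop_ne_abort {f : LTLf (X ⊕ Y) → SearchState X Y → Run (Bool × SearchState X Y)}
    (hc : c.threshold = none) (h : ∀ n s, f n s ≠ .abort) (arcs : List (Move X × LTLf (X ⊕ Y))) :
    ∀ s, c.andLoop f arcs s ≠ .abort := by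
  induction arcs with
  | nil => intro s; simp [andLoop]
  | cons a arcs ih =>
    intro s
    obtain ⟨r, succ⟩ := a
    simp only [andLoop, tooBig, hc, Bool.false_eq_true, if_false]
    rcases hr : f succ s with _ | _ | ⟨_ | _, s'⟩
    · simp
    · exact absurd hr (h _ _)
    · simp
    · exact ih s'

theorem orLoop_ne_abort {f : LTLf (X ⊕ Y) → SearchState X Y → Run (Bool × SearchState X Y)}
    (hc : c.threshold = none) (h : ∀ n s, f n s ≠ .abort) (n : LTLf (X ⊕ Y))
    (arcs : List (Move Y × LTLf (X ⊕ Y))) : ∀ s, c.orLoop f n arcs s ≠ .abort := by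
  induction arcs with
  | nil => intro s; simp [orLoop]
  | cons a arcs ih =>
    intro s
    obtain ⟨act, m⟩ := a
    simp only [orLoop, tooBig, hc, Bool.false_eq_true, if_false]
    rcases hr : c.andLoop f (andArcs c.branching c.repl m) s with _ | _ | ⟨_ | _, s'⟩
    · simp
    · exact absurd hr (c.andLoop_ne_abort hc h _ _)
    · exact ih s'
    · simp

theorem search_ne_abort (hc : c.threshold = none) (fuel : ℕ) :
    ∀ n path s, c.search fuel n path s ≠ .abort := by
  induction fuel with
  | zero => intro n path s; simp [search]
  | succ fuel ih =>
    intro n path s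
    rw [search]
    split_ifs
    any_goals simp
    exact c.orLoop_ne_abort hc (fun m s => ih m _ s) _ _ _

end Config

end Fuel

/-! ### Adequate equivalence checks and termination -/

section Adequate

variable {X : Type u} {Y : Type v} [DecidableEq X] [DecidableEq Y] {K : Type w}

/-- The equivalence check compares a key of the formulas; on the state formulas of `φ`, equal keys
imply propositional equivalence and are preserved by the steps of the game. -/
structure Config.IsAdequate (c : Config X Y) (φ : LTLf (X ⊕ Y)) (key : LTLf (X ⊕ Y) → K) :
    Prop where
  eqCheck_iff : ∀ a b, c.eqCheck a b = true ↔ key a = key b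
  propEquiv : ∀ {a b}, φ.BoolComb a → φ.BoolComb b → key a = key b → a.PropEquiv b
  step : ∀ {a b a' b' S T}, φ.BoolComb a → φ.BoolComb b → key a = key b →
    Step c.branching c.repl a S T a' → Step c.branching c.repl b S T b' → key a' = key b'

namespace Config

variable {c : Config X Y} {φ : LTLf (X ⊕ Y)} {key : LTLf (X ⊕ Y) → K}

theorem IsAdequate.mem_iff (hc : c.IsAdequate φ key) {n : LTLf (X ⊕ Y)}
    {l : List (LTLf (X ⊕ Y))} : c.mem n l = true ↔ ∃ m ∈ l, key n = key m := by
  simp [mem, hc.eqCheck_iff]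

/-- The nodes on the path have different keys, so that their number is bounded when there are
finitely many keys. -/
theorem IsAdequate.search_ne_outOfFuel (hc : c.IsAdequate φ key) (F : Finset K)
    (hF : ∀ ψ, φ.BoolComb ψ → c.tooBig ψ = false → key ψ ∈ F) (fuel : ℕ) :
    ∀ n path s, φ.BoolComb n → c.tooBig n = false → (path.map key).Nodup →
      (∀ k ∈ path.map key, k ∈ F) → F.card < fuel + path.length →
      c.search fuel n path s ≠ .outOfFuel := by
  induction fuel with
  | zero =>
    intro n path s _ _ hnd hsub hlt
    have := (hnd.subperm (l₂ := F.toList) fun k hk => Finset.mem_toList.2 (hsub k hk)).length_le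
    rw [List.length_map, Finset.length_toList] at this
    omega
  | succ fuel ih =>
    intro n path s hn hb hnd hsub hlt
    rw [search]
    split_ifs with h₁ h₂ h₃ h₄
    any_goals simp
    refine c.orLoop_ne_outOfFuel _ _ (fun o ho a ha hab s => ?_) _
    refine ih _ _ _ (boolComb_succ hn ho ha) hab ?_ ?_ (by simp only [List.length_cons]; omega)
    · refine List.nodup_cons.2 ⟨fun h => h₃ (hc.mem_iff.2 ?_), hnd⟩
      obtain ⟨m, hm, e⟩ := List.mem_map.1 h
      exact ⟨m, hm, e.symm⟩
    · simp only [List.map_cons, List.mem_cons, forall_eq_or_imp]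
      exact ⟨hF n hn hb, hsub⟩

end Config

end Adequate

/-! ### The invariant of the search -/

namespace Config

section Extends

variable {X : Type u} {Y : Type v}

/-- The tags only accumulate, apart from the failure tags. -/
structure Extends (s s' : SearchState X Y) : Prop where
  success : s.success ⊆ s'.success
  loop : s.loop ⊆ s'.loop
  expanded : s.expanded ⊆ s'.expanded

theorem Extends.refl (s : SearchState X Y) : Extends s s :=
  ⟨fun _ h => h, fun _ h => h, fun _ h => h⟩

theorem Extends.trans {s s' s'' : SearchState X Y} (h : Extends s s') (h' : Extends s' s'') :
    Extends s s'' :=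
  ⟨fun _ hx => h'.success (h.success hx), fun _ hx => h'.loop (h.loop hx),
    fun _ hx => h'.expanded (h.expanded hx)⟩

end Extends

end Config

section Invariant

variable {X : Type u} {Y : Type v} [DecidableEq X] [DecidableEq Y] {K : Type w}

namespace Config

variable {c : Config X Y} {φ : LTLf (X ⊕ Y)} {key : LTLf (X ⊕ Y) → K}

variable (c) in
/-- The bounded iteration in `ancestors` reaches a fixed point. -/
theorem ancestors_closed (s : SearchState X Y) (n q : LTLf (X ⊕ Y))
    (hmono : ∀ l l' : List (LTLf (X ⊕ Y)), l ⊆ l' → ∀ q, c.hasSuccessorIn l q = true →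
      c.hasSuccessorIn l' q = true)
    (hq : q ∈ s.expanded) (h : c.hasSuccessorIn (n :: c.ancestors s n) q = true) :
    q ∈ c.ancestors s n := by
  set F : List (LTLf (X ⊕ Y)) → List (LTLf (X ⊕ Y)) :=
    fun l => s.expanded.filter (c.hasSuccessorIn (n :: l)) with hF
  have hsub : ∀ k, (F^[k] []).Sublist (F^[k + 1] []) := by
    intro k
    induction k with
    | zero => exact List.nil_sublist _
    | succ k ih =>
      rw [Function.iterate_succ_apply', Function.iterate_succ_apply' F (k + 1)]
      exact List.monotone_filter_right _ fun q =>
        hmono _ _ (List.cons_subset_cons n ih.subset) q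
  -- Before the iteration becomes stationary, each round adds a node.
  have key : ∀ k, F (F^[k] []) = F^[k] [] ∨ k < (F^[k + 1] []).length := by
    intro k
    induction k with
    | zero =>
      rcases hl : F [] with _ | ⟨a, l⟩
      · exact .inl hl
      · exact .inr (by simp [hl])
    | succ k ih =>
      rcases ih with ih | ih
      · left
        rw [Function.iterate_succ_apply' F k, ih, ih]
      · by_cases he : (F^[k + 1] []).length = (F^[k + 2] []).length
        · left
          rw [← Function.iterate_succ_apply' F (k + 1)]
          exact ((hsub (k + 1)).eq_of_length he).symm
        · right
          have := (hsub (k + 1)).length_le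
          exact lt_of_le_of_lt ih (lt_of_le_of_ne this he)
  have hfix : F (c.ancestors s n) = c.ancestors s n := by
    rcases key s.expanded.length with h | h
    · exact h
    · rw [Function.iterate_succ_apply'] at h
      exact absurd (List.length_filter_le _ _) (not_le.2 h)
  rw [← hfix]
  exact List.mem_filter.2 ⟨hq, h⟩

theorem IsAdequate.hasSuccessorIn_iff (hc : c.IsAdequate φ key) {l : List (LTLf (X ⊕ Y))}
    {q : LTLf (X ⊕ Y)} : c.hasSuccessorIn l q = true ↔ ∃ o ∈ orArcs c.branching c.repl q,
      ∃ a ∈ andArcs c.branching c.repl o.2, ∃ m ∈ l, key a.2 = key m := by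
  simp only [hasSuccessorIn, List.any_eq_true, hc.mem_iff]

/-- The recorded strategy is well-founded: each entry is made by a move of the graph that leads
to nodes with older entries only, and no node has two entries. -/
def Justified (c : Config X Y) (φ : LTLf (X ⊕ Y)) : List (LTLf (X ⊕ Y) × Move Y) → Prop
  | [] => True
  | (n, act) :: st => Justified c φ st ∧ φ.BoolComb n ∧ ¬ c.mem n (st.map Prod.fst) = true ∧
      (n.isAccepting = true ∧ act = [] ∨ ∃ m, (act, m) ∈ orArcs c.branching c.repl n ∧
        ∀ a ∈ andArcs c.branching c.repl m, c.mem a.2 (st.map Prod.fst) = true)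

/-- `ψ` is equivalent to a node of `G` or to a node on the path at which a loop was found. -/
def Fails (c : Config X Y) (key : LTLf (X ⊕ Y) → K) (s : SearchState X Y)
    (G : Set (LTLf (X ⊕ Y))) (path : List (LTLf (X ⊕ Y))) (ψ : LTLf (X ⊕ Y)) : Prop :=
  (∃ g ∈ G, key ψ = key g) ∨ ∃ q ∈ path, c.mem q s.loop = true ∧ key ψ = key q

theorem mem_mono {n : LTLf (X ⊕ Y)} {l l' : List (LTLf (X ⊕ Y))} (h : l ⊆ l')
    (hn : c.mem n l = true) : c.mem n l' = true := by
  simp only [mem, List.any_eq_true] at hn ⊢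
  obtain ⟨m, hm, e⟩ := hn
  exact ⟨m, h hm, e⟩

theorem Fails.mono {s s' : SearchState X Y} {G G' : Set (LTLf (X ⊕ Y))}
    {path path' : List (LTLf (X ⊕ Y))} {ψ : LTLf (X ⊕ Y)} (h : Fails c key s G path ψ)
    (hs : s.loop ⊆ s'.loop) (hG : G ⊆ G') (hp : path ⊆ path') : Fails c key s' G' path' ψ := by
  rcases h with ⟨g, hg, e⟩ | ⟨q, hq, hl, e⟩
  · exact .inl ⟨g, hG hg, e⟩
  · exact .inr ⟨q, hp hq, mem_mono hs hl, e⟩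

/-- The part of the invariant that concerns the success tags. -/
structure SuccessInv (c : Config X Y) (φ : LTLf (X ⊕ Y)) (path : List (LTLf (X ⊕ Y)))
    (s : SearchState X Y) : Prop where
  justified : Justified c φ s.strategy
  success_eq : s.success = s.strategy.map Prod.fst
  path_success : ∀ q ∈ path, ¬ c.mem q s.success = true

/-- The invariant of the search. The set `G` consists of nodes that have been found to fail, on
the assumption that the nodes on the path at which loops were found fail. It contains the nodes
tagged as failure, and also nodes whose failure tag has been removed without need by `backProp`,
which removes the tag of all ancestors, whether or not their failure depends on the loop. -/
structure Inv (c : Config X Y) (φ : LTLf (X ⊕ Y)) (key : LTLf (X ⊕ Y) → K)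
    (path : List (LTLf (X ⊕ Y))) (G : Set (LTLf (X ⊕ Y))) (s : SearchState X Y) : Prop
    extends SuccessInv c φ path s where
  failure_subset : ∀ f ∈ s.failure, f ∈ G
  subset_expanded : ∀ g ∈ G, g ∈ s.expanded
  boolComb : ∀ g ∈ s.expanded, φ.BoolComb g
  not_accepting : ∀ g ∈ G, g.isAccepting = false
  refuted : ∀ g ∈ G, ∀ o ∈ orArcs c.branching c.repl g,
    ∃ a ∈ andArcs c.branching c.repl o.2, Fails c key s G path a.2
  path_failure : ∀ q ∈ path, ¬ c.mem q s.failure = true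

/-- The contract of a call of the search with the given path: the set of failing nodes grows, and
the returned value is correct on the assumption that the nodes on the path with a loop fail. -/
def Contract (c : Config X Y) (φ : LTLf (X ⊕ Y)) (key : LTLf (X ⊕ Y) → K)
    (path : List (LTLf (X ⊕ Y))) (G : Set (LTLf (X ⊕ Y))) (s : SearchState X Y)
    (succeeds : SearchState X Y → Prop)
    (fails : SearchState X Y → Set (LTLf (X ⊕ Y)) → Prop) (b : Bool)
    (s' : SearchState X Y) : Prop :=
  ∃ G', G ⊆ G' ∧ Inv c φ key path G' s' ∧ Extends s s' ∧
    (b = true → succeeds s') ∧ (b = false → fails s' G')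

/-- The function `f` satisfies the contract of the search with the given path. -/
def Correct (c : Config X Y) (φ : LTLf (X ⊕ Y)) (key : LTLf (X ⊕ Y) → K)
    (path : List (LTLf (X ⊕ Y)))
    (f : LTLf (X ⊕ Y) → SearchState X Y → Run (Bool × SearchState X Y)) : Prop :=
  ∀ n s G b s', φ.BoolComb n → Inv c φ key path G s → f n s = .done (b, s') →
    Contract c φ key path G s (fun s' => c.mem n s'.success = true)
      (fun s' G' => Fails c key s' G' path n) b s'

theorem andLoop_correct {path : List (LTLf (X ⊕ Y))}
    {f : LTLf (X ⊕ Y) → SearchState X Y → Run (Bool × SearchState X Y)}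
    (hf : Correct c φ key path f) (arcs : List (Move X × LTLf (X ⊕ Y)))
    (harcs : ∀ a ∈ arcs, φ.BoolComb a.2) (s : SearchState X Y) (G : Set (LTLf (X ⊕ Y))) (b : Bool)
    (s' : SearchState X Y) (hI : Inv c φ key path G s) (he : c.andLoop f arcs s = .done (b, s')) :
    Contract c φ key path G s (fun s' => ∀ a ∈ arcs, c.mem a.2 s'.success = true)
      (fun s' G' => ∃ a ∈ arcs, Fails c key s' G' path a.2) b s' := by
  induction arcs generalizing s G with
  | nil =>
    simp only [andLoop, Run.done.injEq, Prod.mk.injEq] at he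
    obtain ⟨rfl, rfl⟩ := he
    exact ⟨G, subset_rfl, hI, Extends.refl _, by simp, by simp⟩
  | cons a arcs ih =>
    obtain ⟨r, succ⟩ := a
    simp only [andLoop] at he
    split_ifs at he
    rcases hr : f succ s with _ | _ | ⟨_ | _, s₁⟩ <;>
      simp only [hr, Run.done.injEq, Prod.mk.injEq, reduceCtorEq] at he
    · obtain ⟨rfl, rfl⟩ := he
      obtain ⟨G₁, hG, hI₁, hs, -, hfail⟩ := hf _ _ _ _ _ (harcs _ (List.mem_cons_self ..)) hI hr
      exact ⟨G₁, hG, hI₁, hs, by simp, fun h => ⟨_, by simp, hfail h⟩⟩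
    · obtain ⟨G₁, hG, hI₁, hs, hsucc, -⟩ := hf _ _ _ _ _ (harcs _ (List.mem_cons_self ..)) hI hr
      obtain ⟨G₂, hG₂, hI₂, hs₂, hsucc₂, hfail₂⟩ :=
        ih (fun a ha => harcs a (List.mem_cons_of_mem _ ha)) s₁ G₁ hI₁ he
      refine ⟨G₂, hG.trans hG₂, hI₂, hs.trans hs₂, fun h => ?_, fun h => ?_⟩
      · simp only [List.mem_cons, forall_eq_or_imp]
        exact ⟨mem_mono hs₂.success (hsucc rfl), hsucc₂ h⟩
      · obtain ⟨a, ha, h⟩ := hfail₂ h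
        exact ⟨a, List.mem_cons_of_mem _ ha, h⟩

theorem IsAdequate.successInv_tagSuccess (hc : c.IsAdequate φ key)
    {path : List (LTLf (X ⊕ Y))} {s : SearchState X Y}
    (hI : SuccessInv c φ path s) {n : LTLf (X ⊕ Y)} {act : Move Y} (hn : φ.BoolComb n)
    (hmem : ¬ c.mem n s.success = true) (hpath : ¬ c.mem n path = true)
    (hact : n.isAccepting = true ∧ act = [] ∨ ∃ m, (act, m) ∈ orArcs c.branching c.repl n ∧
      ∀ a ∈ andArcs c.branching c.repl m, c.mem a.2 s.success = true) :
    SuccessInv c φ path (tagSuccess n act s) := by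
  refine ⟨?_, ?_, ?_⟩
  · rw [hI.success_eq] at hmem hact
    exact ⟨hI.justified, hn, hmem, hact⟩
  · simp [tagSuccess, hI.success_eq]
  · intro q hq h
    obtain ⟨m, hm, e⟩ := hc.mem_iff.1 h
    simp only [tagSuccess, List.mem_cons] at hm
    rcases hm with rfl | hm
    · exact hpath (hc.mem_iff.2 ⟨q, hq, e.symm⟩)
    · exact hI.path_success q hq (hc.mem_iff.2 ⟨m, hm, e⟩)

/-- `s'` results from `s` by tagging nodes as success. -/
structure Promoted (c : Config X Y) (φ : LTLf (X ⊕ Y)) (path : List (LTLf (X ⊕ Y)))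
    (s s' : SearchState X Y) : Prop extends SuccessInv c φ path s' where
  success_subset : s.success ⊆ s'.success
  loop_eq : s'.loop = s.loop
  expanded_eq : s'.expanded = s.expanded

/-- Promoting a node that is not on the path keeps the strategy justified, whatever the reason for
its former failure tag. -/
theorem IsAdequate.promoted_promote (hc : c.IsAdequate φ key)
    {path : List (LTLf (X ⊕ Y))} {s s' : SearchState X Y} (h : Promoted c φ path s s')
    {p : LTLf (X ⊕ Y)} (hp : φ.BoolComb p) (hpath : ¬ c.mem p path = true) :
    Promoted c φ path s (c.promote s' p) := by
  unfold promote
  split_ifs with hm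
  · exact h
  · split
    · exact h
    · rename_i o ho
      have hall : c.allSucceed s' o.2 = true := by simpa using List.find?_some ho
      simp only [allSucceed, List.all_eq_true] at hall
      exact ⟨hc.successInv_tagSuccess h.toSuccessInv hp hm hpath
          (.inr ⟨o.2, List.mem_of_find?_eq_some ho, hall⟩),
        fun x hx => List.mem_cons_of_mem _ (h.success_subset hx), h.loop_eq, h.expanded_eq⟩

theorem IsAdequate.promoted_foldl (hc : c.IsAdequate φ key)
    {path : List (LTLf (X ⊕ Y))} {s : SearchState X Y} (l : List (LTLf (X ⊕ Y)))
    (hl : ∀ p ∈ l, φ.BoolComb p ∧ ¬ c.mem p path = true) :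
    ∀ s', Promoted c φ path s s' → Promoted c φ path s (l.foldl c.promote s') := by
  induction l with
  | nil => exact fun s' h => h
  | cons p l ih =>
    intro s' h
    have := hl p (by simp)
    exact ih (fun q hq => hl q (List.mem_cons_of_mem _ hq)) _ (hc.promoted_promote h this.1 this.2)

theorem IsAdequate.promoted_iterate (hc : c.IsAdequate φ key)
    {path : List (LTLf (X ⊕ Y))} {s : SearchState X Y} (l : List (LTLf (X ⊕ Y)))
    (hl : ∀ p ∈ l, φ.BoolComb p ∧ ¬ c.mem p path = true) (k : ℕ) :
    ∀ s', Promoted c φ path s s' →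
      Promoted c φ path s ((fun s => l.foldl c.promote s)^[k] s') := by
  induction k with
  | zero => exact fun s' h => h
  | succ k ih => exact fun s' h => ih _ (hc.promoted_foldl l hl s' h)

/-- The set of failing nodes after the success of `n` at which a loop was found: of the nodes that
were found to fail during the call, only those are kept that are not ancestors of `n`, while those
known before the call are all kept, since `n` was not yet on the path. -/
theorem IsAdequate.inv_backProp (hc : c.IsAdequate φ key) {n : LTLf (X ⊕ Y)}
    {path : List (LTLf (X ⊕ Y))} {G₀ G : Set (LTLf (X ⊕ Y))} {s₀ s : SearchState X Y}
    (h₀ : Inv c φ key path G₀ s₀) (hs : Extends s₀ s)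
    (hI : Inv c φ key (n :: path) G s) {act : Move Y}
    (hI' : SuccessInv c φ path (tagSuccess n act s)) :
    Inv c φ key path (G₀ ∪ {g ∈ G | ¬ c.mem g (c.ancestors (tagSuccess n act s) n) = true})
      (c.backProp n (tagSuccess n act s)) ∧
    Extends (tagSuccess n act s) (c.backProp n (tagSuccess n act s)) := by
  set s₁ := tagSuccess n act s with hs₁
  set anc := s₁.failure.filter fun f => c.mem f (c.ancestors s₁ n) with hanc
  have hanc' : ∀ p ∈ anc, φ.BoolComb p ∧ ¬ c.mem p path = true := by
    intro p hp
    have hp := (List.mem_filter.1 hp).1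
    refine ⟨hI.boolComb _ (hI.subset_expanded _ (hI.failure_subset _ hp)), fun h => ?_⟩
    obtain ⟨q, hq, e⟩ := hc.mem_iff.1 h
    exact hI.path_failure q (List.mem_cons_of_mem _ hq) (hc.mem_iff.2 ⟨p, hp, e.symm⟩)
  have hP := hc.promoted_iterate (s := s₁) anc hanc' anc.length s₁
    ⟨hI', fun _ h => h, rfl, rfl⟩
  have hloop : (c.backProp n s₁).loop = s.loop := hP.loop_eq
  have hexp : (c.backProp n s₁).expanded = s.expanded := hP.expanded_eq
  have hfailure : (c.backProp n s₁).failure =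
    s.failure.filter fun f => !c.mem f (c.ancestors s₁ n) := rfl
  -- Nodes of `G` with a successor equivalent to `n` or to one of its ancestors are ancestors.
  have hclosed : ∀ g ∈ G, ∀ o ∈ orArcs c.branching c.repl g,
      ∀ a ∈ andArcs c.branching c.repl o.2, ∀ m ∈ n :: c.ancestors s₁ n, key a.2 = key m →
      c.mem g (c.ancestors s₁ n) = true := by
    intro g hg o ho a ha m hm e
    refine hc.mem_iff.2 ⟨g, c.ancestors_closed s₁ n g ?_ (hI.subset_expanded g hg)
      (hc.hasSuccessorIn_iff.2 ⟨o, ho, a, ha, m, hm, e⟩), rfl⟩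
    intro l l' hl q hq
    obtain ⟨o, ho, a, ha, m, hm, e⟩ := hc.hasSuccessorIn_iff.1 hq
    exact hc.hasSuccessorIn_iff.2 ⟨o, ho, a, ha, m, hl hm, e⟩
  refine ⟨⟨⟨hP.justified, hP.success_eq, hP.path_success⟩, ?_, ?_, ?_, ?_, ?_, ?_⟩,
    ⟨hP.success_subset, by rw [hloop]; exact fun _ h => h, by rw [hexp]; exact fun _ h => h⟩⟩
  · intro f hf
    rw [hfailure, List.mem_filter] at hf
    exact .inr ⟨hI.failure_subset f hf.1, by simpa using hf.2⟩
  · rw [hexp]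
    rintro g (hg | hg)
    · exact hs.expanded (h₀.subset_expanded g hg)
    · exact hI.subset_expanded g hg.1
  · rw [hexp]
    exact hI.boolComb
  · rintro g (hg | hg)
    · exact h₀.not_accepting g hg
    · exact hI.not_accepting g hg.1
  · rintro g (hg | hg) o ho
    · obtain ⟨a, ha, h⟩ := h₀.refuted g hg o ho
      exact ⟨a, ha, h.mono (by rw [hloop]; exact hs.loop) Set.subset_union_left fun _ h => h⟩
    · obtain ⟨a, ha, h⟩ := hI.refuted g hg.1 o ho
      refine ⟨a, ha, ?_⟩
      rcases h with ⟨g', hg', e⟩ | ⟨q, hq, hl, e⟩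
      · refine .inl ⟨g', .inr ⟨hg', fun h => hg.2 ?_⟩, e⟩
        obtain ⟨m, hm, e'⟩ := hc.mem_iff.1 h
        exact hclosed g hg.1 o ho a ha m (List.mem_cons_of_mem _ hm) (e.trans e')
      · rcases List.mem_cons.1 hq with rfl | hq
        · exact absurd (hclosed g hg.1 o ho a ha _ (List.mem_cons_self ..) e) hg.2
        · exact .inr ⟨q, hq, by rw [hloop]; exact hl, e⟩
  · intro q hq h
    rw [hfailure] at h
    exact hI.path_failure q (List.mem_cons_of_mem _ hq)
      (mem_mono (fun _ h => (List.mem_filter.1 h).1) h)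

/-- The loop over the or-arcs, after the arcs in `D` have failed. Here `G₀` and `s₀` belong to the
beginning of the call for `n`, before `n` is put on the path. -/
theorem IsAdequate.orLoop_correct (hc : c.IsAdequate φ key) {n : LTLf (X ⊕ Y)}
    {path : List (LTLf (X ⊕ Y))}
    {f : LTLf (X ⊕ Y) → SearchState X Y → Run (Bool × SearchState X Y)}
    (hf : Correct c φ key (n :: path) f) (hn : φ.BoolComb n) (hna : n.isAccepting = false)
    (hpath : ¬ c.mem n path = true) {G₀ : Set (LTLf (X ⊕ Y))} {s₀ : SearchState X Y}
    (h₀ : Inv c φ key path G₀ s₀)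
    (arcs : List (Move Y × LTLf (X ⊕ Y))) (D : List (Move Y × LTLf (X ⊕ Y)))
    (hD : orArcs c.branching c.repl n = D ++ arcs) (s : SearchState X Y)
    (G : Set (LTLf (X ⊕ Y))) (hG : G₀ ⊆ G) (hs : Extends s₀ s)
    (hI : Inv c φ key (n :: path) G s) (hexp : n ∈ s.expanded)
    (hDf : ∀ o ∈ D, ∃ a ∈ andArcs c.branching c.repl o.2, Fails c key s G (n :: path) a.2)
    (b : Bool) (s' : SearchState X Y) (he : c.orLoop f n arcs s = .done (b, s')) :
    Contract c φ key path G₀ s₀ (fun s' => c.mem n s'.success = true)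
      (fun s' G' => Fails c key s' G' path n) b s' := by
  induction arcs generalizing D s G with
  | nil =>
    simp only [orLoop, Run.done.injEq, Prod.mk.injEq] at he
    obtain ⟨rfl, rfl⟩ := he
    simp only [List.append_nil] at hD
    have hmono : ∀ {ψ}, Fails c key s G (n :: path) ψ →
        Fails c key { s with failure := n :: s.failure } (insert n G) path ψ := by
      rintro ψ (⟨g, hg, e⟩ | ⟨q, hq, hl, e⟩)
      · exact .inl ⟨g, .inr hg, e⟩
      · rcases List.mem_cons.1 hq with rfl | hq
        · exact .inl ⟨q, .inl rfl, e⟩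
        · exact .inr ⟨q, hq, hl, e⟩
    refine ⟨insert n G, hG.trans (Set.subset_insert _ _), ⟨⟨hI.justified, hI.success_eq,
      fun q hq => hI.path_success q (List.mem_cons_of_mem _ hq)⟩, ?_, ?_, hI.boolComb, ?_, ?_, ?_⟩,
      ⟨hs.success, hs.loop, hs.expanded⟩, by simp, fun _ => .inl ⟨n, .inl rfl, rfl⟩⟩
    · intro f hf
      rcases List.mem_cons.1 hf with rfl | hf
      · exact .inl rfl
      · exact .inr (hI.failure_subset f hf)
    · rintro g (rfl | hg)
      · exact hexp
      · exact hI.subset_expanded g hg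
    · rintro g (rfl | hg)
      · exact hna
      · exact hI.not_accepting g hg
    · rintro g (rfl | hg) o ho
      · obtain ⟨a, ha, h⟩ := hDf o (hD ▸ ho)
        exact ⟨a, ha, hmono h⟩
      · obtain ⟨a, ha, h⟩ := hI.refuted g hg o ho
        exact ⟨a, ha, hmono h⟩
    · intro q hq h
      obtain ⟨m, hm, e⟩ := hc.mem_iff.1 h
      rcases List.mem_cons.1 hm with rfl | hm
      · exact hpath (hc.mem_iff.2 ⟨q, hq, e.symm⟩)
      · exact hI.path_failure q (List.mem_cons_of_mem _ hq) (hc.mem_iff.2 ⟨m, hm, e⟩)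
  | cons o arcs ih =>
    obtain ⟨act, m⟩ := o
    have ho : (act, m) ∈ orArcs c.branching c.repl n := by simp [hD]
    simp only [orLoop] at he
    split_ifs at he
    rcases hr : c.andLoop f (andArcs c.branching c.repl m) s with _ | _ | ⟨_ | _, s₁⟩ <;>
      simp only [hr, Run.done.injEq, Prod.mk.injEq, reduceCtorEq] at he
    · obtain ⟨G₁, hG₁, hI₁, hs₁, -, hfail⟩ := andLoop_correct hf _
        (fun a ha => boolComb_succ hn ho ha) _ _ _ _ hI hr
      refine ih (D ++ [(act, m)]) (by simp [hD]) s₁ G₁ (hG.trans hG₁) (hs.trans hs₁) hI₁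
        (hs₁.expanded hexp) ?_ he
      intro o ho
      rcases List.mem_append.1 ho with ho | ho
      · obtain ⟨a, ha, h⟩ := hDf o ho
        exact ⟨a, ha, h.mono hs₁.loop hG₁ fun _ h => h⟩
      · rw [List.mem_singleton.1 ho]
        exact hfail rfl
    · obtain ⟨rfl, rfl⟩ := he
      obtain ⟨G₁, hG₁, hI₁, hs₁, hsucc, -⟩ := andLoop_correct hf _
        (fun a ha => boolComb_succ hn ho ha) _ _ _ _ hI hr
      have hS : SuccessInv c φ path (tagSuccess n act s₁) :=
        hc.successInv_tagSuccess ⟨hI₁.justified, hI₁.success_eq,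
            fun q hq => hI₁.path_success q (List.mem_cons_of_mem _ hq)⟩ hn
          (hI₁.path_success n (List.mem_cons_self ..)) hpath (.inr ⟨m, ho, hsucc rfl⟩)
      have hext : Extends s₁ (tagSuccess n act s₁) :=
        ⟨fun _ h => List.mem_cons_of_mem _ h, fun _ h => h, fun _ h => h⟩
      have hmem : c.mem n (tagSuccess n act s₁).success = true :=
        hc.mem_iff.2 ⟨n, List.mem_cons_self .., rfl⟩
      split_ifs with hl
      · obtain ⟨hB, hB'⟩ := hc.inv_backProp h₀ (hs.trans hs₁) hI₁ hS
        exact ⟨_, Set.subset_union_left, hB, ((hs.trans hs₁).trans hext).trans hB',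
          fun _ => mem_mono hB'.success hmem, by simp⟩
      -- No loop was found at `n`, so no failure depends on the assumption that `n` fails.
      · refine ⟨G₁, hG.trans hG₁, ⟨hS, hI₁.failure_subset, hI₁.subset_expanded, hI₁.boolComb,
          hI₁.not_accepting, ?_, fun q hq => hI₁.path_failure q (List.mem_cons_of_mem _ hq)⟩,
          (hs.trans hs₁).trans hext, fun _ => hmem, by simp⟩
        intro g hg o ho
        obtain ⟨a, ha, h⟩ := hI₁.refuted g hg o ho
        refine ⟨a, ha, ?_⟩
        rcases h with ⟨g', hg', e⟩ | ⟨q, hq, hq', e⟩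
        · exact .inl ⟨g', hg', e⟩
        · rcases List.mem_cons.1 hq with rfl | hq
          · exact absurd hq' hl
          · exact .inr ⟨q, hq, hq', e⟩

theorem IsAdequate.search_correct (hc : c.IsAdequate φ key) (fuel : ℕ) :
    ∀ path, Correct c φ key path fun n s => c.search fuel n path s := by
  induction fuel with
  | zero =>
    intro path n s G b s' hn hI he
    simp [search] at he
  | succ fuel ih =>
    intro path n s G b s' hn hI he
    simp only [search] at he
    split_ifs at he with h₁ h₂ h₃ h₄
    · simp only [Run.done.injEq, Prod.mk.injEq] at he
      obtain ⟨rfl, rfl⟩ := he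
      exact ⟨G, subset_rfl, hI, Extends.refl _, fun _ => h₁, by simp⟩
    · simp only [Run.done.injEq, Prod.mk.injEq] at he
      obtain ⟨rfl, rfl⟩ := he
      obtain ⟨f, hf, e⟩ := hc.mem_iff.1 h₂
      exact ⟨G, subset_rfl, hI, Extends.refl _, by simp,
        fun _ => .inl ⟨f, hI.failure_subset f hf, e⟩⟩
    · simp only [Run.done.injEq, Prod.mk.injEq] at he
      obtain ⟨rfl, rfl⟩ := he
      obtain ⟨q, hq, e⟩ := hc.mem_iff.1 h₃
      have hloop : s.loop ⊆ n :: s.loop := fun _ h => List.mem_cons_of_mem _ h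
      refine ⟨G, subset_rfl, ⟨⟨hI.justified, hI.success_eq, hI.path_success⟩, hI.failure_subset,
        hI.subset_expanded, hI.boolComb, hI.not_accepting, ?_, hI.path_failure⟩,
        ⟨fun _ h => h, hloop, fun _ h => h⟩, by simp,
        fun _ => .inr ⟨q, hq, hc.mem_iff.2 ⟨n, List.mem_cons_self .., e.symm⟩, e⟩⟩
      intro g hg o ho
      obtain ⟨a, ha, h⟩ := hI.refuted g hg o ho
      exact ⟨a, ha, h.mono hloop subset_rfl fun _ h => h⟩
    · simp only [Run.done.injEq, Prod.mk.injEq] at he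
      obtain ⟨rfl, rfl⟩ := he
      exact ⟨G, subset_rfl, ⟨hc.successInv_tagSuccess hI.toSuccessInv hn h₁ h₃ (.inl ⟨h₄, rfl⟩),
        hI.failure_subset, hI.subset_expanded, hI.boolComb, hI.not_accepting, hI.refuted,
        hI.path_failure⟩, ⟨fun _ h => List.mem_cons_of_mem _ h, fun _ h => h, fun _ h => h⟩,
        fun _ => hc.mem_iff.2 ⟨n, List.mem_cons_self .., rfl⟩, by simp⟩
    · have hexp : s.expanded ⊆ n :: s.expanded := fun _ h => List.mem_cons_of_mem _ h
      refine hc.orLoop_correct (ih (n :: path)) hn (by simpa using h₄) h₃ hI _ [] rfl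
        { s with expanded := n :: s.expanded } G subset_rfl
        ⟨fun _ h => h, fun _ h => h, hexp⟩ ⟨⟨hI.justified, hI.success_eq, ?_⟩, hI.failure_subset,
          fun g hg => hexp (hI.subset_expanded g hg), ?_, hI.not_accepting, ?_, ?_⟩
        (List.mem_cons_self ..) (by simp) b s' he
      · simp only [List.mem_cons, forall_eq_or_imp]
        exact ⟨h₁, hI.path_success⟩
      · simp only [List.mem_cons, forall_eq_or_imp]
        exact ⟨hn, hI.boolComb⟩
      · intro g hg o ho
        obtain ⟨a, ha, h⟩ := hI.refuted g hg o ho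
        exact ⟨a, ha, h.mono (fun _ h => h) subset_rfl fun _ h => List.mem_cons_of_mem _ h⟩
      · simp only [List.mem_cons, forall_eq_or_imp]
        exact ⟨h₂, hI.path_failure⟩

end Config

end Invariant

/-! ### Adequacy of the two equivalence checks -/

section Bdd

theorem LTLf.BoolComb.pa_xnf_mem {P : Type u} {φ ψ : LTLf P} {ord : List (LTLf P)}
    (hord : IsVariableOrder φ ord) (hψ : φ.BoolComb ψ) : ∀ α ∈ ψ.xnf.pa, α ∈ ord := by
  induction hψ with
  | base h => exact hord _ h
  | tt => simp [LTLf.xnf, LTLf.pa]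
  | ff => simp [LTLf.xnf, LTLf.pa]
  | and _ _ iha ihb | or _ _ iha ihb =>
    intro α hα
    simp only [LTLf.xnf, LTLf.pa, List.mem_append] at hα
    exact hα.elim (iha α) (ihb α)

variable {P : Type u} [DecidableEq P]

/-- The Boolean function that a decision diagram represents. -/
def Bdd.eval {A : Type u} (D : A → Bool) : Bdd A → Bool
  | .leaf b => b
  | .node a lo hi => if D a then hi.eval D else lo.eval D

theorem Bdd.eval_mk {A : Type u} [DecidableEq A] (D : A → Bool) (a : A) (lo hi : Bdd A) :
    (Bdd.mk a lo hi).eval D = if D a then hi.eval D else lo.eval D := by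
  unfold Bdd.mk
  split_ifs <;> simp_all [Bdd.eval]

theorem eval_bddRepresentation (f : PForm P) (D : LTLf P → Bool) (ord : List (LTLf P)) :
    ∀ C, (bddRepresentation f ord C).eval D = f.evalPa fun α => if α ∈ ord then D α else C α := by
  induction ord with
  | nil => intro C; simp [bddRepresentation, Bdd.eval]
  | cons a ord ih =>
    intro C
    rw [bddRepresentation, Bdd.eval_mk, ih, ih]
    have : ∀ b, D a = b →
        (fun α => if α ∈ ord then D α else Function.update C a b α) =
          fun α => if α ∈ a :: ord then D α else C α := by
      rintro b rfl
      funext α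
      by_cases h : α ∈ ord <;> by_cases h' : α = a <;> simp_all
    cases h : D a
    · rw [← this _ h]; simp
    · rw [← this _ h]; simp

theorem bddRepresentation_congr {f g : PForm P} (h : ∀ C, f.evalPa C = g.evalPa C)
    (ord : List (LTLf P)) : ∀ C, bddRepresentation f ord C = bddRepresentation g ord C := by
  induction ord with
  | nil => intro C; simp [bddRepresentation, h]
  | cons a ord ih => intro C; simp [bddRepresentation, ih]

theorem finite_bddRepresentation (ord : List (LTLf P)) :
    {D | ∃ f C, D = bddRepresentation (P := P) f ord C}.Finite := by
  induction ord with
  | nil =>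
    refine (Set.finite_range Bdd.leaf).subset ?_
    rintro _ ⟨f, C, rfl⟩
    exact ⟨_, rfl⟩
  | cons a ord ih =>
    refine (Set.Finite.image2 (Bdd.mk a) ih ih).subset ?_
    rintro _ ⟨f, C, rfl⟩
    exact ⟨_, ⟨f, _, rfl⟩, _, ⟨f, _, rfl⟩, rfl⟩

theorem propEquiv_of_bdd_eq {φ ψ₁ ψ₂ : LTLf P} {ord : List (LTLf P)} (hord : IsVariableOrder φ ord)
    (h₁ : φ.BoolComb ψ₁) (h₂ : φ.BoolComb ψ₂) {C₀ : LTLf P → Bool}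
    (h : bddRepresentation ψ₁.xnf.prop ord C₀ = bddRepresentation ψ₂.xnf.prop ord C₀) :
    ψ₁.PropEquiv ψ₂ := by
  intro C
  have e := congrArg (Bdd.eval C) h
  rw [eval_bddRepresentation, eval_bddRepresentation] at e
  rw [LTLf.evalPa_prop_congr ψ₁.xnf (D := fun α => if α ∈ ord then C α else C₀ α),
    LTLf.evalPa_prop_congr ψ₂.xnf (D := fun α => if α ∈ ord then C α else C₀ α), e]
  · intro α hα
    simp [h₂.pa_xnf_mem hord α hα]
  · intro α hα
    simp [h₁.pa_xnf_mem hord α hα]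

end Bdd

section EquivalenceChecks

variable {X : Type u} {Y : Type v} [DecidableEq X] [DecidableEq Y]

theorem isAdequate_hashConsing (t : Option ℕ) (B : Branching X Y) (R : Replacement (X ⊕ Y))
    (φ : LTLf (X ⊕ Y)) : (Config.mk hashConsingEqCheck t B R).IsAdequate φ id where
  eqCheck_iff a b := by simp [hashConsingEqCheck]
  propEquiv := by
    rintro a b _ _ rfl C
    rfl
  step := by
    rintro a b a' b' S T _ _ rfl h h'
    exact h.unique h'

theorem isAdequate_bddBased (t : Option ℕ) (B : Branching X Y) (R : Replacement (X ⊕ Y))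
    (φ : LTLf (X ⊕ Y)) (ord : List (LTLf (X ⊕ Y))) (hord : IsVariableOrder φ ord) :
    (Config.mk (bddBasedEqCheck ord) t B R).IsAdequate φ
      fun ψ => bddRepresentation ψ.xnf.prop ord fun _ => false where
  eqCheck_iff a b := by simp [bddBasedEqCheck]
  propEquiv h₁ h₂ h := propEquiv_of_bdd_eq hord h₁ h₂ h
  step h₁ h₂ h s₁ s₂ :=
    bddRepresentation_congr (s₁.propEquiv s₂ h₁ h₂ (propEquiv_of_bdd_eq hord h₁ h₂ h)) ord _

end EquivalenceChecks

/-! ### Plays and state formulas -/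

section Plays

theorem play_succ {X : Type u} {Y : Type v} (g : List (Set X) → Set Y) (env : ℕ → Set X)
    (k : ℕ) :
    play g env (k + 1) = play g env k ++ [letter (env k) (g ((List.range k).map env))] := by
  simp [play, List.range_succ]

variable {X : Type u} {Y : Type v} [DecidableEq X] [DecidableEq Y]
  {B : Branching X Y} {R : Replacement (X ⊕ Y)} {φ : LTLf (X ⊕ Y)}

theorem StateAfter.snoc {g : List (Set X) → Set Y} {h : List (Set X)} {ψ ψ' : LTLf (X ⊕ Y)}
    {A : Set X} (hψ : StateAfter B R φ g h ψ) (hs : Step B R ψ (g h) A ψ') :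
    StateAfter B R φ g (h ++ [A]) ψ' := by
  obtain ⟨o, ho, hS, a, ha, hT, rfl⟩ := hs
  exact .step hψ ho hS ha hT

theorem StateAfter.boolComb {g : List (Set X) → Set Y} {h : List (Set X)} {ψ : LTLf (X ⊕ Y)}
    (hψ : StateAfter B R φ g h ψ) : φ.BoolComb ψ := by
  induction hψ with
  | init => exact .base φ.self_mem_cl
  | step _ ho _ ha _ ih => exact boolComb_succ ih ho ha

/-- A strategy that follows a controller is obtained by simulating the controller, provided that
its moves are consistent. -/
theorem exists_follows (B : Branching X Y) (R : Replacement (X ⊕ Y)) (φ : LTLf (X ⊕ Y))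
    (ctrl : Controller X Y) (hctrl : ∀ ψ act, ctrl ψ = some act → ∃ S, Agrees S act) :
    ∃ g, Follows B R φ ctrl g := by
  have hmove : ∀ ψ, ∃ S, ∀ act, ctrl ψ = some act → Agrees S act := by
    intro ψ
    rcases h : ctrl ψ with _ | act
    · exact ⟨∅, by simp⟩
    · obtain ⟨S, hS⟩ := hctrl ψ act h
      exact ⟨S, by rintro _ ⟨⟩; exact hS⟩
  choose move hmove using hmove
  choose next hnext using exists_step B R
  let st : List (Set X) → LTLf (X ⊕ Y) := fun h => h.foldl (fun ψ A => next ψ (move ψ) A) φ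
  have hst : ∀ h ψ, StateAfter B R φ (fun h => move (st h)) h ψ → ψ = st h := by
    intro h ψ hψ
    induction hψ with
    | init => rfl
    | @step h ψ m ψ' act resp A _ ho hS ha hT ih =>
      subst ih
      have : Step B R (st h) (move (st h)) A ψ' := ⟨_, ho, hS, _, ha, hT, rfl⟩
      rw [this.unique (hnext _ _ _)]
      simp [st]
  refine ⟨fun h => move (st h), fun h ψ act hψ hact => ?_⟩
  have := hmove ψ act hact
  rwa [hst h ψ hψ] at this

end Plays

/-! ### Correctness of the two outcomes of the search -/

section Outcomes

variable {X : Type u} {Y : Type v} [DecidableEq X] [DecidableEq Y] {K : Type w}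

namespace Config

variable {c : Config X Y} {φ : LTLf (X ⊕ Y)} {key : LTLf (X ⊕ Y) → K}

theorem Justified.consistent {st : List (LTLf (X ⊕ Y) × Move Y)} (h : Justified c φ st) :
    ∀ e ∈ st, ∃ S, Agrees S e.2 := by
  induction st with
  | nil => simp
  | cons e st ih =>
    obtain ⟨n, act⟩ := e
    obtain ⟨h, -, -, hact⟩ := h
    simp only [List.mem_cons, forall_eq_or_imp]
    refine ⟨?_, ih h⟩
    rcases hact with ⟨-, rfl⟩ | ⟨m, hm, -⟩
    · exact ⟨∅, by simp [Agrees]⟩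
    · exact orArc_consistent hm

theorem Justified.of_append {pre st : List (LTLf (X ⊕ Y) × Move Y)}
    (h : Justified c φ (pre ++ st)) :
    Justified c φ st ∧ ∀ e ∈ pre, ∀ e' ∈ st, c.eqCheck e.1 e'.1 = false := by
  induction pre with
  | nil => exact ⟨h, by simp⟩
  | cons e pre ih =>
    obtain ⟨n, act⟩ := e
    obtain ⟨h, -, hmem, -⟩ := h
    refine ⟨(ih h).1, ?_⟩
    simp only [List.mem_cons, forall_eq_or_imp]
    refine ⟨fun e' he' => ?_, (ih h).2⟩
    by_contra hne
    refine hmem (List.any_eq_true.2 ⟨e'.1, ?_, by simpa using hne⟩)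
    exact List.mem_map.2 ⟨e', List.mem_append_right _ he', rfl⟩

/-- A play that reaches a node with an entry in the strategy reaches an accepting state, by
induction on the position of the entry. -/
theorem IsAdequate.exists_models_play (hc : c.IsAdequate φ key) {s : SearchState X Y}
    (hs : Justified c φ s.strategy) {g : List (Set X) → Set Y}
    (hg : Follows c.branching c.repl φ (c.getStrategy s) g) (env : ℕ → Set X)
    (st : List (LTLf (X ⊕ Y) × Move Y)) :
    ∀ pre, s.strategy = pre ++ st → ∀ k ψ,
      StateAfter c.branching c.repl φ g ((List.range k).map env) ψ →
      (∀ ρ, LTLf.Models (play g env k ++ ρ) φ ↔ LTLf.Models ρ ψ) →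
      c.mem ψ (st.map Prod.fst) = true → ∃ k, LTLf.Models (play g env k) φ := by
  induction st with
  | nil =>
    intro pre _ k ψ _ _ h
    simp [mem] at h
  | cons e st ih =>
    obtain ⟨n, act⟩ := e
    intro pre hpre k ψ hψ hmod hmem
    have hrec := ih (pre ++ [(n, act)]) (by simp [hpre])
    rw [hpre] at hs
    obtain ⟨⟨hs, hn, -, hact⟩, hdisj⟩ := hs.of_append
    by_cases he : key ψ = key n
    -- No newer entry has the same key, so the controller prescribes the move of this entry.
    · rcases hact with ⟨hacc, -⟩ | ⟨m, hm, hsucc⟩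
      · refine ⟨k, ?_⟩
        have := (hmod []).2 ((LTLf.isAccepting_iff ψ).1
          ((hc.propEquiv hψ.boolComb hn he).isAccepting_eq ▸ hacc))
        rwa [List.append_nil] at this
      · have hfind : c.getStrategy s ψ = some act := by
          have hnone : pre.find? (fun e => c.eqCheck ψ e.1) = none := by
            refine List.find?_eq_none.2 fun e hepre h => ?_
            have := hdisj e hepre (n, act) (List.mem_cons_self ..)
            rw [(hc.eqCheck_iff _ _).2 (((hc.eqCheck_iff _ _).1 h).symm.trans he)] at this
            exact absurd this (by simp)
          simp [getStrategy, hpre, List.find?_append, hnone, (hc.eqCheck_iff _ _).2 he]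
        have hS := hg _ _ _ hψ hfind
        obtain ⟨a, ha, hT⟩ := exists_andArc c.branching c.repl m (env k)
        obtain ⟨ψ', hψ'⟩ := exists_step c.branching c.repl ψ (g ((List.range k).map env)) (env k)
        have hkey : key ψ' = key a.2 :=
          hc.step hψ.boolComb hn he hψ' ⟨(act, m), hm, hS, a, ha, hT, rfl⟩
        refine hrec (k + 1) ψ' ?_ ?_ ?_
        · rw [List.range_succ, List.map_append]
          exact hψ.snoc hψ'
        · intro ρ
          rw [play_succ, List.append_assoc, hmod, List.singleton_append,
            hψ'.models_cons_iff hψ.boolComb]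
        · obtain ⟨m', hm', e'⟩ := hc.mem_iff.1 (hsucc a ha)
          exact hc.mem_iff.2 ⟨m', hm', hkey.trans e'⟩
    · refine hrec k ψ hψ hmod ?_
      obtain ⟨m', hm', e'⟩ := hc.mem_iff.1 hmem
      rcases List.mem_cons.1 hm' with rfl | hm'
      · exact absurd e' he
      · exact hc.mem_iff.2 ⟨m', hm', e'⟩

/-- A justified strategy with an entry for the initial state is a winning controller. -/
theorem IsAdequate.isWinning_getStrategy (hc : c.IsAdequate φ key) {s : SearchState X Y}
    (hs : Justified c φ s.strategy) (hφ : c.mem φ (s.strategy.map Prod.fst) = true) :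
    (c.getStrategy s).IsWinning c.branching c.repl φ := by
  refine ⟨exists_follows _ _ _ _ fun ψ act h => ?_, fun g hg env =>
    hc.exists_models_play hs hg env s.strategy [] rfl 0 φ .init (fun ρ => by simp [play]) hφ⟩
  obtain ⟨e, he, rfl⟩ := Option.map_eq_some_iff.1 h
  exact hs.consistent e (List.mem_of_find?_eq_some he)

/-- Against any strategy, the environment can keep the play among states that are equivalent to
failing nodes. None of them is accepting. -/
theorem IsAdequate.not_realizable (hc : c.IsAdequate φ key) {s : SearchState X Y}
    {G : Set (LTLf (X ⊕ Y))} (hI : Inv c φ key [] G s) (hφ : ∃ n ∈ G, key φ = key n) :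
    ¬ Realizable φ := by
  rintro ⟨g, hg⟩
  let L : Set (LTLf (X ⊕ Y)) := {ψ | φ.BoolComb ψ ∧ ∃ n ∈ G, key ψ = key n}
  have hbc : ∀ n ∈ G, φ.BoolComb n := fun n hn => hI.boolComb n (hI.subset_expanded n hn)
  have hstep : ∀ (h : List (Set X)) (ψ : L), ∃ T : Set X, ∃ ψ' : L,
      Step c.branching c.repl ψ.1 (g h) T ψ'.1 := by
    rintro h ⟨ψ, hψ, n, hn, e⟩
    obtain ⟨o, ho, hS⟩ := exists_orArc c.branching c.repl n (g h)
    obtain ⟨a, ha, hfail⟩ := hI.refuted n hn o ho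
    obtain ⟨T, hT⟩ := andArc_consistent ha
    obtain ⟨ψ', hψ'⟩ := exists_step c.branching c.repl ψ (g h) T
    have hkey : key ψ' = key a.2 := hc.step hψ (hbc n hn) e hψ' ⟨o, ho, hS, a, ha, hT, rfl⟩
    refine ⟨T, ⟨ψ', hψ'.boolComb hψ, ?_⟩, hψ'⟩
    rcases hfail with ⟨n', hn', e'⟩ | ⟨q, hq, -⟩
    · exact ⟨n', hn', hkey.trans e'⟩
    · simp at hq
  choose env next hnext using hstep
  let run : ℕ → List (Set X) × L := fun k =>
    k.rec ([], ⟨φ, .base φ.self_mem_cl, hφ⟩) fun _ p => (p.1 ++ [env p.1 p.2], next p.1 p.2)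
  let e : ℕ → Set X := fun k => env (run k).1 (run k).2
  have hrun : ∀ k, (run k).1 = (List.range k).map e := by
    intro k
    induction k with
    | zero => rfl
    | succ k ih =>
      rw [List.range_succ, List.map_append, ← ih]
      rfl
  have hmod : ∀ k ρ, LTLf.Models (play g e k ++ ρ) φ ↔ LTLf.Models ρ (run k).2.1 := by
    intro k
    induction k with
    | zero =>
      intro ρ
      simp only [play, List.range_zero, List.map_nil, List.nil_append]
      rfl
    | succ k ih =>
      intro ρ
      rw [play_succ, List.append_assoc, ih, List.singleton_append, ← hrun k]
      exact (hnext (run k).1 (run k).2).models_cons_iff (run k).2.2.1 ρ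
  obtain ⟨k, hk⟩ := hg e
  obtain ⟨hψ, n, hn, hkey⟩ := (run k).2.2
  rw [← List.append_nil (play g e k), hmod, ← LTLf.isAccepting_iff,
    (hc.propEquiv hψ (hbc n hn) hkey).isAccepting_eq, hI.not_accepting n hn] at hk
  exact absurd hk (by simp)

/-- The synthesis procedure has the same outcome for all large bounds on the recursion depth: it
is aborted because of the threshold, or its answer is correct. -/
theorem IsAdequate.synthesis_correct (hc : c.IsAdequate φ key)
    (hfin : (key '' {ψ | φ.BoolComb ψ ∧ c.tooBig ψ = false}).Finite) :
    ∃ r, (∃ N, ∀ fuel ≥ N, c.synthesis fuel φ = r) ∧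
      (c.threshold ≠ none ∧ r = .abort ∨ ∃ out, r = .done out ∧
        (out.isSome = true ↔ Realizable φ) ∧
        ∀ ctrl, out = some ctrl → ctrl.IsWinning c.branching c.repl φ) := by
  have hsome : ∀ ctrl : Controller X Y, ctrl.IsWinning c.branching c.repl φ →
      ((some ctrl).isSome = true ↔ Realizable φ) ∧
        ∀ ctrl', some ctrl = some ctrl' → ctrl'.IsWinning c.branching c.repl φ := by
    intro ctrl h
    refine ⟨⟨fun _ => ?_, fun _ => rfl⟩, by rintro _ ⟨⟩; exact h⟩
    obtain ⟨⟨g, hg⟩, hw⟩ := h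
    exact ⟨g, hw g hg⟩
  by_cases hacc : φ.isAccepting = true
  · refine ⟨_, ⟨0, fun fuel _ => by simp only [synthesis, hacc, if_true]; rfl⟩,
      .inr ⟨_, rfl, hsome _ (hc.isWinning_getStrategy ?_ ?_)⟩⟩
    · exact ⟨trivial, .base φ.self_mem_cl, by simp [mem], .inl ⟨hacc, rfl⟩⟩
    · exact hc.mem_iff.2 ⟨φ, by simp, rfl⟩
  by_cases hbig : c.tooBig φ = true
  · refine ⟨.abort, ⟨0, fun fuel _ => by simp [synthesis, hacc, hbig]⟩, .inl ⟨fun h => ?_, rfl⟩⟩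
    simp [tooBig, h] at hbig
  have hfuel := hc.search_ne_outOfFuel hfin.toFinset
    (fun ψ hψ hb => hfin.mem_toFinset.2 ⟨ψ, ⟨hψ, hb⟩, rfl⟩) (hfin.toFinset.card + 1) φ []
    ⟨[], [], [], [], []⟩ (.base φ.self_mem_cl) (by simpa using hbig) (by simp) (by simp) (by simp)
  refine ⟨c.synthesis (hfin.toFinset.card + 1) φ, ⟨hfin.toFinset.card + 1, fun fuel h => ?_⟩, ?_⟩
  · simp only [synthesis, c.search_eq_of_le h hfuel]
  have hI : Inv c φ key [] ∅ ⟨[], [], [], [], []⟩ :=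
    ⟨⟨trivial, rfl, by simp⟩, by simp, by simp, by simp, by simp, by simp, by simp⟩
  rcases hr : c.search (hfin.toFinset.card + 1) φ [] ⟨[], [], [], [], []⟩ with
    _ | _ | ⟨_ | _, s⟩ <;>
    simp only [synthesis, hacc, hbig, hr, Bool.false_eq_true, if_false]
  · exact absurd hr hfuel
  · exact .inl ⟨fun h => c.search_ne_abort h _ _ _ _ hr, trivial⟩
  · obtain ⟨G, -, hI', -, -, hfail⟩ := hc.search_correct _ [] _ _ _ _ _ (.base φ.self_mem_cl) hI hr
    refine .inr ⟨none, rfl, ?_, by simp⟩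
    have hφ : ∃ n ∈ G, key φ = key n := by
      rcases hfail rfl with h | ⟨q, hq, -⟩
      · exact h
      · simp at hq
    simp [hc.not_realizable hI' hφ]
  · obtain ⟨G, -, hI', -, hsucc, -⟩ := hc.search_correct _ [] _ _ _ _ _ (.base φ.self_mem_cl) hI hr
    exact .inr ⟨_, rfl, hsome _ (hc.isWinning_getStrategy hI'.justified
      (hI'.success_eq ▸ hsucc rfl))⟩

end Config

end Outcomes

end LTLfSynthesis

open LTLfSynthesis

theorem mainTheorem2 {X : Type*} {Y : Type*} [DecidableEq X] [DecidableEq Y]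
    (B : Branching X Y) (R : Replacement (X ⊕ Y))
    (φ : LTLf (X ⊕ Y)) (ord : List (LTLf (X ⊕ Y))) (hord : IsVariableOrder φ ord) (t : ℕ) :
    ∃ out : Option (Controller X Y),
      (∃ N : ℕ, ∀ fuel ≥ N, hashThenBddSynthesis B R ord t fuel φ = Run.done out) ∧
      (out.isSome = true ↔ Realizable φ) ∧
      ∀ ctrl : Controller X Y, out = some ctrl → ctrl.IsWinning B R φ := by
  obtain ⟨r, ⟨N, hN⟩, h⟩ := (isAdequate_hashConsing (some t) B R φ).synthesis_correct
    (((φ.finite_boolComb_size_le t).subset fun ψ h =>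
      ⟨h.1, by simpa [Config.tooBig] using h.2⟩).image _)
  rcases h with ⟨-, rfl⟩ | ⟨out, rfl, h⟩
  · obtain ⟨r', ⟨N', hN'⟩, h'⟩ := (isAdequate_bddBased none B R φ ord hord).synthesis_correct
      ((finite_bddRepresentation ord).subset (by rintro _ ⟨ψ, -, rfl⟩; exact ⟨_, _, rfl⟩))
    rcases h' with ⟨h', -⟩ | ⟨out, rfl, h'⟩
    · exact absurd rfl h'
    · refine ⟨out, ⟨max N N', fun fuel hf => ?_⟩, h'⟩
      rw [hashThenBddSynthesis, hN fuel (le_of_max_le_left hf)]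
      exact hN' fuel (le_of_max_le_right hf)
  · refine ⟨out, ⟨N, fun fuel hf => ?_⟩, h⟩
    rw [hashThenBddSynthesis, hN fuel hf]
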